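/- Let $\mathbb{H}$ be the real quaternions with basis $1,i,j,k$ and let $\mathcal{H}\subset\mathbb{H}$ be the ring of Hurwitz integers, i.e. of the quaternions $\tfrac12(a+bi+cj+dk)$ with $a,b,c,d\in\mathbb{Z}$ all of the same parity. Regard $\mathbb{H}^t$ as a left $\mathbb{H}$-module and as a Euclidean space with norm $\|x\|^2=\sum_{i=1}^t|x_i|^2$; write $\mathrm{Vol}(\mathbb{B}(r))$ for the Lebesgue measure of the closed ball of radius $r$ about $0$ in $\mathbb{H}^t$, and $\mathrm{Vol}(\mathcal{H}^t)$ for the covolume of the lattice $\mathcal{H}^t\subset\mathbb{H}^t$. For a lattice $\Lambda\subset\mathbb{H}^t$ and $1\le j\le t$, the $j$-th quaternionic minimum $\min_j(\Lambda)$ is the smallest $r$ such that $\mathbb{B}(r)$ contains $j$ vectors of $\Lambda$ that are linearly independent over $\mathbb{H}$ (for the left action). Let $0<\varepsilon<1$ and, for every $t$, let $p=p(t)$ be an odd prime such that $t^2=o(p)$ as $t\to\infty$. Then for all sufficiently large $t$ the following holds. The ring $\mathcal{H}/p\mathcal{H}$ is isomorphic to $M_2(\mathbb{F}_p)$. For every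 choice of such an isomorphism, let $\phi_p:\mathcal{H}^t\to(\mathcal{H}/p\mathcal{H})^t\cong M_2(\mathbb{F}_p)^t$ be the coordinatewise reduction map, let $\mathcal{C}_{t+1}$ be the set of left $M_2(\mathbb{F}_p)$-submodules of $M_2(\mathbb{F}_p)^t$ isomorphic to the direct sum of $t+1$ copies of the simple left module $\mathbb{F}_p^2$, and let $$\mathbb{L}_p=\left\{p^{\frac{1-t}{2t}}\phi_p^{-1}(C)\;:\;C\in\mathcal{C}_{t+1}\right\}.$$ Then some $\Lambda\in\mathbb{L}_p$ is a lattice in $\mathbb{H}^t$ (discrete and spanning $\mathbb{H}^t$ over $\mathbb{R}$) which is a free left $\mathcal{H}$-module of rank $t$ and satisfies $$\left(\prod_{j=1}^t\min\nolimits_j(\Lambda)\right)^{1/t}>r,$$ where $r>0$ is defined by $$\mathrm{Vol}(\mathbb{B}(r))=(1-\varepsilon)\,\frac{24\,t\,\mathrm{Vol}(\mathcal{H}^t)\,\zeta(4t)}{e\,(1-e^{-t})}.$$ -/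

import Mathlib

open MeasureTheory Filter Asymptotics
open scoped Quaternion Topology Matrix.Module

noncomputable section

namespace HurwitzCodes

/-- The ring of Hurwitz integers, as a subring of the real quaternions: the quaternions
`(a + b i + c j + d k) / 2` with integers `a, b, c, d` of the same parity, that is, the quaternions
whose four coordinates are either all integers or all halves of odd integers. -/
def hurwitz : Subring ℍ[ℝ] where
  carrier := {q | ∃ a b c d : ℤ, 2 ∣ b - a ∧ 2 ∣ c - a ∧ 2 ∣ d - a ∧
    q.re = a / 2 ∧ q.imI = b / 2 ∧ q.imJ = c / 2 ∧ q.imK = d / 2}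
  mul_mem' := by
    rintro p q ⟨a, b, c, d, ⟨x, hx⟩, ⟨y, hy⟩, ⟨z, hz⟩, h₀, h₁, h₂, h₃⟩
      ⟨a', b', c', d', ⟨x', hx'⟩, ⟨y', hy'⟩, ⟨z', hz'⟩, h₀', h₁', h₂', h₃'⟩
    obtain rfl : b = a + 2 * x := by lia
    obtain rfl : c = a + 2 * y := by lia
    obtain rfl : d = a + 2 * z := by lia
    obtain rfl : b' = a' + 2 * x' := by lia
    obtain rfl : c' = a' + 2 * y' := by lia
    obtain rfl : d' = a' + 2 * z' := by lia
    refine ⟨-(a * a') - a * (x' + y' + z') - a' * (x + y + z) - 2 * (x * x' + y * y' + z * z'),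
      a * a' + a * x' + a' * x + (a * z' + y * a' + 2 * y * z') - (a * y' + z * a' + 2 * z * y'),
      a * a' + a * y' + a' * y + (a * x' + z * a' + 2 * z * x') - (a * z' + x * a' + 2 * x * z'),
      a * a' + a * z' + a' * z + (a * y' + x * a' + 2 * x * y') - (a * x' + y * a' + 2 * y * x'),
      by lia, by lia, by lia, ?_, ?_, ?_, ?_⟩
    all_goals
      simp only [Quaternion.re_mul, Quaternion.imI_mul, Quaternion.imJ_mul, Quaternion.imK_mul,
        h₀, h₁, h₂, h₃, h₀', h₁', h₂', h₃']
      push_cast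
      ring
  one_mem' := ⟨2, 0, 0, 0, by simp⟩
  add_mem' := by
    rintro p q ⟨a, b, c, d, h₁, h₂, h₃, e₀, e₁, e₂, e₃⟩
      ⟨a', b', c', d', h₁', h₂', h₃', e₀', e₁', e₂', e₃'⟩
    refine ⟨a + a', b + b', c + c', d + d', by lia, by lia, by lia, ?_, ?_, ?_, ?_⟩
    all_goals
      simp only [Quaternion.re_add, Quaternion.imI_add, Quaternion.imJ_add, Quaternion.imK_add, *]
      push_cast
      ring
  zero_mem' := ⟨0, 0, 0, 0, by simp⟩
  neg_mem' := by
    rintro p ⟨a, b, c, d, h₁, h₂, h₃, e₀, e₁, e₂, e₃⟩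
    refine ⟨-a, -b, -c, -d, by lia, by lia, by lia, ?_, ?_, ?_, ?_⟩
    all_goals
      simp only [Quaternion.re_neg, Quaternion.imI_neg, Quaternion.imJ_neg, Quaternion.imK_neg, *]
      push_cast
      ring

/-- The left `ℍ`-module `ℍ^t` with the Euclidean norm `‖x‖² = ∑ |x i|²`. -/
abbrev HSpace (t : ℕ) : Type := PiLp 2 (fun _ : Fin t => ℍ[ℝ])

instance (t : ℕ) : MeasurableSpace (HSpace t) := borel _

instance (t : ℕ) : BorelSpace (HSpace t) := ⟨rfl⟩

/-- The inclusion of the `t`-tuples of Hurwitz integers into `ℍ^t`. -/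
def inclusion {t : ℕ} (x : Fin t → hurwitz) : HSpace t :=
  WithLp.toLp 2 fun i => (x i : ℍ[ℝ])

/-- The lattice of all points of `ℍ^t` whose coordinates are Hurwitz integers, as a `ℤ`-module. -/
def hurwitzLattice (t : ℕ) : Submodule ℤ (HSpace t) where
  carrier := {v | ∀ i, v i ∈ hurwitz}
  add_mem' hv hw i := add_mem (hv i) (hw i)
  zero_mem' _ := zero_mem _
  smul_mem' n _ hv i := zsmul_mem (hv i) n

/-- The volume of a fundamental domain of the lattice `H^t` in `ℍ^t`, for the Lebesgue measure
`volume` of the Euclidean space `ℍ^t`. -/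
def hurwitzCovolume (t : ℕ) : ℝ := ZLattice.covolume (hurwitzLattice t)

/-- The `k`-th quaternionic minimum of `Λ`: the smallest `r` such that the closed ball of radius `r`
contains `k` vectors of `Λ` which are linearly independent for the left action of `ℍ`. -/
def quatMin {t : ℕ} (Λ : Submodule hurwitz (HSpace t)) (k : ℕ) : ℝ :=
  sInf {r : ℝ | ∃ v : Fin k → HSpace t,
    (∀ i, v i ∈ Λ ∧ v i ∈ Metric.closedBall 0 r) ∧ LinearIndependent ℍ[ℝ] v}

/-- The two-sided ideal `pH` of the ring `H` of Hurwitz integers. -/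
def idealP (p : ℕ) : Ideal hurwitz := Ideal.span {(p : hurwitz)}

instance (p : ℕ) : (idealP p).IsTwoSided := ⟨fun {a} b ha => by
  obtain ⟨c, rfl⟩ := Ideal.mem_span_singleton'.1 ha
  exact Ideal.mem_span_singleton'.2 ⟨c * b, by
    rw [mul_assoc, mul_assoc, (Nat.cast_commute p b).eq]⟩⟩

/-- The matrix ring `M₂(𝔽_p)`. -/
abbrev Mat (p : ℕ) : Type := Matrix (Fin 2) (Fin 2) (ZMod p)

/-- The reduction map `H^t → (H/pH)^t ≅ M₂(𝔽_p)^t` attached to an identification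
`e : H/pH ≅ M₂(𝔽_p)`. -/
def reduction {p : ℕ} (e : hurwitz ⧸ idealP p ≃+* Mat p) {t : ℕ} (x : Fin t → hurwitz) :
    Fin t → Mat p :=
  fun i => e (Ideal.Quotient.mk (idealP p) (x i))

/-- The set of left `M₂(𝔽_p)`-submodules of `M₂(𝔽_p)^t` isomorphic to `k` copies of the simple left
module `𝔽_p²` of column vectors (on which matrices act by multiplication). -/
def codes (p t k : ℕ) : Set (Submodule (Mat p) (Fin t → Mat p)) :=
  {C | Nonempty (C ≃ₗ[Mat p] (Fin k → Fin 2 → ZMod p))}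

/-- The set of rescaled lifts `p ^ ((1 - t) / (2t)) • φ_p⁻¹(C)`, where `C` runs over the submodules
of `M₂(𝔽_p)^t` isomorphic to `t + 1` copies of `𝔽_p²`, and `φ_p` is the reduction map. -/
def rescaledLifts {p : ℕ} (e : hurwitz ⧸ idealP p ≃+* Mat p) (t : ℕ) : Set (Set (HSpace t)) :=
  {L | ∃ C ∈ codes p t (t + 1),
    L = (fun x => (p : ℝ) ^ ((1 - t : ℝ) / (2 * t)) • inclusion x) '' (reduction e ⁻¹' C)}

end HurwitzCodes

end

open HurwitzCodes

/-!
Averaging, as in the Minkowski–Hlawka theorem, over a family of codes.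

The `t`-tuples of `2 × 2` matrices over `𝔽_p` are the `2 × 2t` matrices, and a left submodule
consists of the matrices whose rows lie in a subspace of `𝔽_p^(2t)`. The family used here is formed
by the graphs of all linear maps `𝔽_p^(t+1) → 𝔽_p^(t-1)` (`graphCode`). A matrix with independent
rows lies in a proportion of at most `p^(-2(t-1))` of these codes, a nonzero matrix in a proportion
of at most `p^(-(t-1))` (`card_graph_mul_le`). With `β = p^((1-t)/(2t))` the first proportion is
exactly `β^(4t)`, so for a function `f` of the norm the mean of `∑ f(βx)` over the nonzero vectors
of the lifted code is at most the Riemann sum `β^(4t) ∑ f(βx)` over the Hurwitz vectors, plus an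
error from the vectors whose reductions have dependent rows (`exists_graphCode_sum_le`). Vectors
reducing to zero have norm at least `p` and are outside the support of `f`.

The function `f` is Rogers' truncated logarithm (`weight`), whose integral is
`Vol(B(r)) e (1 - e^(-t)) / t`. If the geometric mean of the minima of a lattice is at most `r`,
then `t` independent vectors realizing small minima have total weight at least `1`
(`one_le_sum_weight`), and their multiples by the `24` Hurwitz units have total weight at least `24`
(`lt_prod_quatMin`). Hence it is enough that the mean is less than `24`. For the radius `r` in question, the integral
divided by the covolume is `24 (1 - ε) ζ(4t)`, and `ζ(4t) → 1`.

It remains to see that the errors vanish. Since `r` has the exact order `√t` (`sqrt_le_radius`,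
`radius_le`), the Riemann sum exceeds the integral by a factor of at most `exp(O(t β))`
(`sum_weight_le`), and `t β → 0` because `t² = o(p)` (`mul_rpow_le`). A Hurwitz vector whose
reduction has dependent rows is killed modulo `p` by a row vector `c ≠ 0`; for a fixed `c` such
vectors differ in a coordinate that is not invertible modulo `p`, hence of norm divisible by `p`, so they
are at mutual distance at least `√p`. A packing argument bounds their number in the relevant ball by
`O(t²)^t` (`card_not_linearIndependent_le`), and `p² O(t²)^t / p^(t-1) → 0` (`dependent_error_le`).

Freeness of the lattice holds because the Hurwitz integers are left Euclidean, hence left ideals are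
principal (`nonempty_basis_of_smul_single_mem`), and `H/pH ≅ M₂(𝔽_p)` is given explicitly by a
solution of `s² + t² = -1` in `𝔽_p` (`toMat`).
-/

noncomputable section

namespace HurwitzCodes

/-! ### Arithmetic of the Hurwitz integers -/

theorem normSq_eq (q : ℍ[ℝ]) :
    Quaternion.normSq q = q.re ^ 2 + q.imI ^ 2 + q.imJ ^ 2 + q.imK ^ 2 :=
  Quaternion.normSq_def' q

theorem exists_normSq_eq_natCast {q : ℍ[ℝ]} (hq : q ∈ hurwitz) :
    ∃ n : ℕ, Quaternion.normSq q = n := by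
  obtain ⟨a, b, c, d, ⟨x, hx⟩, ⟨y, hy⟩, ⟨z, hz⟩, h₀, h₁, h₂, h₃⟩ := hq
  obtain rfl : b = a + 2 * x := by lia
  obtain rfl : c = a + 2 * y := by lia
  obtain rfl : d = a + 2 * z := by lia
  have hn : Quaternion.normSq q =
      ((a ^ 2 + a * (x + y + z) + x ^ 2 + y ^ 2 + z ^ 2 : ℤ) : ℝ) := by
    rw [normSq_eq, h₀, h₁, h₂, h₃]
    push_cast
    ring
  have h0 : 0 ≤ a ^ 2 + a * (x + y + z) + x ^ 2 + y ^ 2 + z ^ 2 := by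
    have := Quaternion.normSq_nonneg (a := q)
    rw [hn] at this
    exact_mod_cast this
  refine ⟨(a ^ 2 + a * (x + y + z) + x ^ 2 + y ^ 2 + z ^ 2).toNat, ?_⟩
  rw [hn, ← Int.cast_natCast, Int.toNat_of_nonneg h0]

/-- The squared norm of a Hurwitz integer, as a natural number. -/
def sqNorm (q : hurwitz) : ℕ := (exists_normSq_eq_natCast q.2).choose

theorem normSq_eq_sqNorm (q : hurwitz) : Quaternion.normSq (q : ℍ[ℝ]) = sqNorm q :=
  (exists_normSq_eq_natCast q.2).choose_spec

theorem norm_sq_eq_sqNorm (q : hurwitz) : ‖(q : ℍ[ℝ])‖ ^ 2 = sqNorm q := by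
  rw [← normSq_eq_sqNorm, Quaternion.normSq_eq_norm_mul_self, sq]

theorem star_mem_hurwitz {q : ℍ[ℝ]} (hq : q ∈ hurwitz) : star q ∈ hurwitz := by
  obtain ⟨a, b, c, d, h₁, h₂, h₃, e₀, e₁, e₂, e₃⟩ := hq
  refine ⟨a, -b, -c, -d, by lia, by lia, by lia, ?_, ?_, ?_, ?_⟩ <;> simp [*] <;> ring

/-- Every quaternion is at distance less than `1` from a Hurwitz integer: rounding the
coordinates leaves an error of norm at most `1`, and the error is `1` only if all coordinates
are halves of odd integers. -/
theorem exists_hurwitz_norm_sub_lt (q : ℍ[ℝ]) : ∃ h : hurwitz, ‖q - h‖ < 1 := by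
  have key : ∀ h : hurwitz, Quaternion.normSq (q - (h : ℍ[ℝ])) < 1 → ‖q - h‖ < 1 := fun h hh => by
    rw [Quaternion.normSq_eq_norm_mul_self] at hh
    nlinarith [norm_nonneg (q - (h : ℍ[ℝ]))]
  have habs := fun x : ℝ => abs_sub_round x
  let u : hurwitz := ⟨⟨round q.re, round q.imI, round q.imJ, round q.imK⟩,
    2 * round q.re, 2 * round q.imI, 2 * round q.imJ, 2 * round q.imK,
    by lia, by lia, by lia, by simp, by simp, by simp, by simp⟩
  have hu : Quaternion.normSq (q - (u : ℍ[ℝ])) =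
      (q.re - round q.re) ^ 2 + (q.imI - round q.imI) ^ 2 +
      (q.imJ - round q.imJ) ^ 2 + (q.imK - round q.imK) ^ 2 := by
    rw [normSq_eq]
    rfl
  have hsq : ∀ x : ℝ, (x - round x) ^ 2 ≤ 1 / 4 := fun x => by
    rw [← sq_abs]
    nlinarith [habs x, abs_nonneg (x - round x)]
  by_cases hlt : Quaternion.normSq (q - (u : ℍ[ℝ])) < 1
  · exact ⟨u, key u hlt⟩
  · rw [hu] at hlt
    -- all four rounding errors are extremal, so `q` is itself a Hurwitz integer
    have hodd : ∀ x : ℝ, (x - round x) ^ 2 = 1 / 4 → ∃ m : ℤ, x = ((2 * m + 1 : ℤ) : ℝ) / 2 := by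
      intro x hx
      have : (x - round x - 1 / 2) * (x - round x + 1 / 2) = 0 := by linarith
      rcases mul_eq_zero.1 this with h | h
      · exact ⟨round x, by push_cast; linarith⟩
      · exact ⟨round x - 1, by push_cast; linarith⟩
    obtain ⟨a, ha⟩ := hodd q.re (by linarith [hsq q.re, hsq q.imI, hsq q.imJ, hsq q.imK])
    obtain ⟨b, hb⟩ := hodd q.imI (by linarith [hsq q.re, hsq q.imI, hsq q.imJ, hsq q.imK])
    obtain ⟨c, hc⟩ := hodd q.imJ (by linarith [hsq q.re, hsq q.imI, hsq q.imJ, hsq q.imK])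
    obtain ⟨d, hd⟩ := hodd q.imK (by linarith [hsq q.re, hsq q.imI, hsq q.imJ, hsq q.imK])
    have hq : q ∈ hurwitz := ⟨_, _, _, _, by lia, by lia, by lia, ha, hb, hc, hd⟩
    exact ⟨⟨q, hq⟩, by simp⟩

/-- The Hurwitz integers are Euclidean for the norm, so every left ideal is principal. -/
instance : IsPrincipalIdealRing hurwitz where
  principal I := by
    by_cases hI : I = ⊥
    · exact ⟨0, by simp [hI]⟩
    obtain ⟨b, ⟨hbI, hb0⟩, hmin⟩ := WellFounded.has_min (measure sqNorm).wf
      {x | x ∈ I ∧ x ≠ 0} ((Submodule.ne_bot_iff I).1 hI)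
    refine ⟨b, le_antisymm (fun a ha => ?_)
      ((Submodule.span_singleton_le_iff_mem b I).2 hbI)⟩
    obtain ⟨c, hc⟩ := exists_hurwitz_norm_sub_lt ((a : ℍ[ℝ]) * (b : ℍ[ℝ])⁻¹)
    have hb0' : (b : ℍ[ℝ]) ≠ 0 := fun h => hb0 (Subtype.ext h)
    have hrem : a - c * b = 0 := by
      by_contra hne
      refine hmin (a - c * b) ⟨I.sub_mem ha (I.mul_mem_left c hbI), hne⟩ ?_
      change sqNorm (a - c * b) < sqNorm b
      have he : ((a - c * b : hurwitz) : ℍ[ℝ]) = ((a : ℍ[ℝ]) * (b : ℍ[ℝ])⁻¹ - c) * b := by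
        rw [sub_mul, mul_assoc, inv_mul_cancel₀ hb0', mul_one]
        rfl
      have hlt : ‖((a - c * b : hurwitz) : ℍ[ℝ])‖ < ‖(b : ℍ[ℝ])‖ := by
        rw [he, norm_mul]
        exact mul_lt_of_lt_one_left (norm_pos_iff.2 hb0') hc
      have := pow_lt_pow_left₀ hlt (norm_nonneg _) two_ne_zero
      rw [norm_sq_eq_sqNorm, norm_sq_eq_sqNorm] at this
      exact_mod_cast this
    rw [sub_eq_zero.1 hrem]
    exact Submodule.mem_span_singleton.2 ⟨c, rfl⟩

/-- Over a domain all of whose left ideals are principal, a submodule of `R^n` that contains a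
nonzero scalar multiple of each standard basis vector is free of rank `n`. The basis is built
along the filtration by the submodules of vectors supported on the first `k` coordinates. -/
theorem nonempty_basis_of_smul_single_mem {R : Type*} [Ring R] [IsDomain R]
    [IsPrincipalIdealRing R] {n : ℕ} (N : Submodule R (Fin n → R)) {a : R} (ha : a ≠ 0)
    (hN : ∀ i, Pi.single i a ∈ N) : Nonempty (Module.Basis (Fin n) R N) := by
  let T : ℕ → Submodule R (Fin n → R) := fun k =>
    { carrier := {x | x ∈ N ∧ ∀ i : Fin n, k ≤ i → x i = 0}
      add_mem' := fun hx hy => ⟨N.add_mem hx.1 hy.1, fun i hi => by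
        simp [hx.2 i hi, hy.2 i hi]⟩
      zero_mem' := ⟨N.zero_mem, fun _ _ => rfl⟩
      smul_mem' := fun c _ hx => ⟨N.smul_mem c hx.1, fun i hi => by simp [hx.2 i hi]⟩ }
  have key : ∀ k ≤ n, Nonempty (Module.Basis (Fin k) R (T k)) := by
    intro k
    induction k with
    | zero =>
      intro _
      have : Subsingleton (T 0) := ⟨fun x y => Subtype.ext <| funext fun i => by
        rw [x.2.2 i (Nat.zero_le _), y.2.2 i (Nat.zero_le _)]⟩
      exact ⟨Module.Basis.empty _⟩
    | succ k ih =>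
      intro hk
      obtain ⟨b⟩ := ih (by lia)
      let κ : Fin n := ⟨k, hk⟩
      let I : Ideal R := (T (k + 1)).map (LinearMap.proj κ : (Fin n → R) →ₗ[R] R)
      obtain ⟨d, hd⟩ := (IsPrincipalIdealRing.principal I).principal
      have hdI : d ∈ I := hd ▸ Submodule.mem_span_singleton_self d
      obtain ⟨y, hy, hyd⟩ := hdI
      replace hyd : y κ = d := hyd
      have hd0 : d ≠ 0 := by
        rintro rfl
        have haI : a ∈ I := ⟨Pi.single κ a, ⟨hN κ, fun i hi => by
          have : i ≠ κ := fun h => by subst h; simp [κ] at hi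
          simp [this]⟩, by simp⟩
        rw [hd] at haI
        simp [ha] at haI
      refine ⟨Module.Basis.mkFinConsOfLE y hy b (fun x hx => ⟨hx.1, fun i hi => hx.2 i (by lia)⟩)
        (fun c x hx hcx => ?_) (fun z hz => ?_)⟩
      · have := congrFun hcx κ
        simp only [Pi.add_apply, Pi.smul_apply, hyd, hx.2 κ le_rfl, Pi.zero_apply, add_zero,
          smul_eq_mul] at this
        exact (mul_eq_zero.1 this).resolve_right hd0
      · have hzI : z κ ∈ I := ⟨z, hz, rfl⟩
        rw [hd] at hzI
        obtain ⟨c, hc⟩ := Submodule.mem_span_singleton.1 hzI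
        refine ⟨-c, ⟨N.add_mem hz.1 (N.smul_mem _ hy.1), fun i hi => ?_⟩⟩
        rcases hi.eq_or_lt with h | h
        · have : i = κ := Fin.ext h.symm
          subst this
          rw [Pi.add_apply, Pi.smul_apply, hyd, ← hc, neg_smul, add_neg_cancel]
        · simp [hz.2 i h, hy.2 i h]
  obtain ⟨b⟩ := key n le_rfl
  have hT : T n = N := le_antisymm (fun x hx => hx.1)
    (fun x hx => ⟨hx, fun i hi => absurd i.2 (by lia)⟩)
  exact ⟨hT ▸ b⟩

/-- The quadruples of integers of the same parity with sum of squares `4`: twice the coordinates of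
the Hurwitz units. -/
def quadruplesOfSqSumFour : Finset (ℤ × ℤ × ℤ × ℤ) :=
  (Finset.Icc (-2) 2 ×ˢ Finset.Icc (-2) 2 ×ˢ Finset.Icc (-2) 2 ×ˢ Finset.Icc (-2) 2).filter
    fun x => (2 ∣ x.2.1 - x.1 ∧ 2 ∣ x.2.2.1 - x.1 ∧ 2 ∣ x.2.2.2 - x.1) ∧
      x.1 ^ 2 + x.2.1 ^ 2 + x.2.2.1 ^ 2 + x.2.2.2 ^ 2 = 4

theorem card_quadruplesOfSqSumFour : quadruplesOfSqSumFour.card = 24 := by decide +kernel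

/-- There are (at least) `24` Hurwitz integers of norm `1`. -/
theorem exists_finset_norm_eq_one :
    ∃ U : Finset hurwitz, U.card = 24 ∧ ∀ u ∈ U, ‖(u : ℍ[ℝ])‖ = 1 := by
  have hQ' : ∀ x : quadruplesOfSqSumFour,
      (2 ∣ x.1.2.1 - x.1.1 ∧ 2 ∣ x.1.2.2.1 - x.1.1 ∧ 2 ∣ x.1.2.2.2 - x.1.1) ∧
        x.1.1 ^ 2 + x.1.2.1 ^ 2 + x.1.2.2.1 ^ 2 + x.1.2.2.2 ^ 2 = 4 := fun x =>
    (Finset.mem_filter.1 x.2).2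
  let f : quadruplesOfSqSumFour → hurwitz := fun x =>
    ⟨⟨x.1.1 / 2, x.1.2.1 / 2, x.1.2.2.1 / 2, x.1.2.2.2 / 2⟩,
    x.1.1, x.1.2.1, x.1.2.2.1, x.1.2.2.2, (hQ' x).1.1, (hQ' x).1.2.1, (hQ' x).1.2.2,
    rfl, rfl, rfl, rfl⟩
  have hf : Function.Injective f := by
    rintro ⟨⟨a, b, c, d⟩, hx⟩ ⟨⟨a', b', c', d'⟩, hy⟩ h
    have h := congrArg (fun z : hurwitz => (z : ℍ[ℝ])) h
    have h0 := congrArg QuaternionAlgebra.re h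
    have h1 := congrArg QuaternionAlgebra.imI h
    have h2 := congrArg QuaternionAlgebra.imJ h
    have h3 := congrArg QuaternionAlgebra.imK h
    have hdiv : ∀ m n : ℤ, (m : ℝ) / 2 = n / 2 → m = n := fun m n hmn => by
      have : (m : ℝ) = n := by linarith
      exact_mod_cast this
    have e0 := hdiv _ _ h0
    have e1 := hdiv _ _ h1
    have e2 := hdiv _ _ h2
    have e3 := hdiv _ _ h3
    simp only at e0 e1 e2 e3
    subst e0 e1 e2 e3
    rfl
  refine ⟨Finset.univ.map ⟨f, hf⟩, by simp [card_quadruplesOfSqSumFour], fun u hu => ?_⟩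
  obtain ⟨x, -, rfl⟩ := Finset.mem_map.1 hu
  have hn : Quaternion.normSq ((f x : hurwitz) : ℍ[ℝ]) = 1 := by
    rw [normSq_eq]
    have := (hQ' x).2
    have h4 : (x.1.1 : ℝ) ^ 2 + x.1.2.1 ^ 2 + x.1.2.2.1 ^ 2 + x.1.2.2.2 ^ 2 = 4 := by
      exact_mod_cast this
    simp only [f]
    linarith
  rw [Quaternion.normSq_eq_norm_mul_self] at hn
  change ‖((f x : hurwitz) : ℍ[ℝ])‖ = 1
  nlinarith [norm_nonneg ((f x : hurwitz) : ℍ[ℝ])]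

/-! ### Reduction modulo an odd prime -/

theorem two_dvd_sub_of_odd_mul {p : ℕ} (hp : Odd p) {a b : ℤ} (h : 2 ∣ (p : ℤ) * b - p * a) :
    2 ∣ b - a := by
  rw [← mul_sub] at h
  exact (Int.isCoprime_iff_gcd_eq_one.2 (by
    exact_mod_cast Nat.coprime_two_left.2 hp)).dvd_of_dvd_mul_left h

theorem round_two_mul_div_two (a : ℤ) : round (2 * ((a : ℝ) / 2)) = a := by
  rw [mul_div_cancel₀ _ (two_ne_zero), round_intCast]

/-- Twice the real part of a Hurwitz integer. -/
def twoRe (q : hurwitz) : ℤ := round (2 * (q : ℍ[ℝ]).re)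
/-- Twice the `i`-coordinate of a Hurwitz integer. -/
def twoImI (q : hurwitz) : ℤ := round (2 * (q : ℍ[ℝ]).imI)
/-- Twice the `j`-coordinate of a Hurwitz integer. -/
def twoImJ (q : hurwitz) : ℤ := round (2 * (q : ℍ[ℝ]).imJ)
/-- Twice the `k`-coordinate of a Hurwitz integer. -/
def twoImK (q : hurwitz) : ℤ := round (2 * (q : ℍ[ℝ]).imK)

theorem cast_twoRe (q : hurwitz) : (twoRe q : ℝ) = 2 * (q : ℍ[ℝ]).re := by
  obtain ⟨a, b, c, d, -, -, -, h, -, -, -⟩ := q.2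
  rw [twoRe, h, round_two_mul_div_two, mul_div_cancel₀ _ two_ne_zero]

theorem cast_twoImI (q : hurwitz) : (twoImI q : ℝ) = 2 * (q : ℍ[ℝ]).imI := by
  obtain ⟨a, b, c, d, -, -, -, -, h, -, -⟩ := q.2
  rw [twoImI, h, round_two_mul_div_two, mul_div_cancel₀ _ two_ne_zero]

theorem cast_twoImJ (q : hurwitz) : (twoImJ q : ℝ) = 2 * (q : ℍ[ℝ]).imJ := by
  obtain ⟨a, b, c, d, -, -, -, -, -, h, -⟩ := q.2
  rw [twoImJ, h, round_two_mul_div_two, mul_div_cancel₀ _ two_ne_zero]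

theorem cast_twoImK (q : hurwitz) : (twoImK q : ℝ) = 2 * (q : ℍ[ℝ]).imK := by
  obtain ⟨a, b, c, d, -, -, -, -, -, -, h⟩ := q.2
  rw [twoImK, h, round_two_mul_div_two, mul_div_cancel₀ _ two_ne_zero]

theorem two_dvd_sub_twoRe (q : hurwitz) :
    2 ∣ twoImI q - twoRe q ∧ 2 ∣ twoImJ q - twoRe q ∧ 2 ∣ twoImK q - twoRe q := by
  obtain ⟨a, b, c, d, h₁, h₂, h₃, e₀, e₁, e₂, e₃⟩ := q.2
  rw [twoRe, twoImI, twoImJ, twoImK, e₀, e₁, e₂, e₃, round_two_mul_div_two, round_two_mul_div_two,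
    round_two_mul_div_two, round_two_mul_div_two]
  exact ⟨h₁, h₂, h₃⟩

theorem twoRe_mul (q r : hurwitz) : 2 * twoRe (q * r) = twoRe q * twoRe r -
    twoImI q * twoImI r - twoImJ q * twoImJ r - twoImK q * twoImK r := by
  rify
  simp only [cast_twoRe, cast_twoImI, cast_twoImJ, cast_twoImK, Subring.coe_mul,
    Quaternion.re_mul]
  ring

theorem twoImI_mul (q r : hurwitz) : 2 * twoImI (q * r) = twoRe q * twoImI r +
    twoImI q * twoRe r + twoImJ q * twoImK r - twoImK q * twoImJ r := by
  rify
  simp only [cast_twoRe, cast_twoImI, cast_twoImJ, cast_twoImK, Subring.coe_mul,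
    Quaternion.imI_mul]
  ring

theorem twoImJ_mul (q r : hurwitz) : 2 * twoImJ (q * r) = twoRe q * twoImJ r -
    twoImI q * twoImK r + twoImJ q * twoRe r + twoImK q * twoImI r := by
  rify
  simp only [cast_twoRe, cast_twoImI, cast_twoImJ, cast_twoImK, Subring.coe_mul,
    Quaternion.imJ_mul]
  ring

theorem twoImK_mul (q r : hurwitz) : 2 * twoImK (q * r) = twoRe q * twoImK r +
    twoImI q * twoImJ r - twoImJ q * twoImI r + twoImK q * twoRe r := by
  rify
  simp only [cast_twoRe, cast_twoImI, cast_twoImJ, cast_twoImK, Subring.coe_mul,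
    Quaternion.imK_mul]
  ring

theorem twoRe_add (q r : hurwitz) : twoRe (q + r) = twoRe q + twoRe r := by
  rify; simp only [cast_twoRe, Subring.coe_add, Quaternion.re_add]; ring

theorem twoImI_add (q r : hurwitz) : twoImI (q + r) = twoImI q + twoImI r := by
  rify; simp only [cast_twoImI, Subring.coe_add, Quaternion.imI_add]; ring

theorem twoImJ_add (q r : hurwitz) : twoImJ (q + r) = twoImJ q + twoImJ r := by
  rify; simp only [cast_twoImJ, Subring.coe_add, Quaternion.imJ_add]; ring

theorem twoImK_add (q r : hurwitz) : twoImK (q + r) = twoImK q + twoImK r := by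
  rify; simp only [cast_twoImK, Subring.coe_add, Quaternion.imK_add]; ring

/-- For `s ^ 2 + t ^ 2 = -1` in `𝔽_p`, the ring homomorphism from the Hurwitz integers to
`M₂(𝔽_p)` with `i ↦ [[0, -1], [1, 0]]` and `j ↦ [[s, t], [t, -s]]`. -/
def toMat {p : ℕ} [Fact p.Prime] {s t : ZMod p} (hst : s ^ 2 + t ^ 2 + 1 = 0)
    (h2 : (2 : ZMod p) ≠ 0) : hurwitz →+* Mat p where
  toFun q := (2 : ZMod p)⁻¹ •
    !![twoRe q + twoImJ q * s - twoImK q * t, -twoImI q + twoImJ q * t + twoImK q * s;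
       twoImI q + twoImJ q * t + twoImK q * s, twoRe q - twoImJ q * s + twoImK q * t]
  map_zero' := by
    ext i j; fin_cases i <;> fin_cases j <;> simp [twoRe, twoImI, twoImJ, twoImK]
  map_one' := by
    have h : twoRe 1 = 2 := by
      rify; rw [cast_twoRe]; simp
    ext i j; fin_cases i <;> fin_cases j <;> simp [h, twoImI, twoImJ, twoImK, h2]
  map_add' q r := by
    ext i j; fin_cases i <;> fin_cases j <;>
      simp [twoRe_add, twoImI_add, twoImJ_add, twoImK_add] <;> ring
  map_mul' q r := by
    have hh : (2 : ZMod p)⁻¹ * 2 = 1 := inv_mul_cancel₀ h2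
    have h0 := congrArg (Int.cast : ℤ → ZMod p) (twoRe_mul q r)
    have h1 := congrArg (Int.cast : ℤ → ZMod p) (twoImI_mul q r)
    have h2 := congrArg (Int.cast : ℤ → ZMod p) (twoImJ_mul q r)
    have h3 := congrArg (Int.cast : ℤ → ZMod p) (twoImK_mul q r)
    push_cast at h0 h1 h2 h3
    generalize (2 : ZMod p)⁻¹ = h at *
    have e : ∀ x y : ZMod p, 2 * x = y → x = h * y := fun x y hxy => by
      rw [← hxy, ← mul_assoc, hh, one_mul]
    replace h0 := e _ _ h0
    replace h1 := e _ _ h1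
    replace h2 := e _ _ h2
    replace h3 := e _ _ h3
    have hs : s ^ 2 = -1 - t ^ 2 := by linear_combination hst
    rw [h0, h1, h2, h3]
    ext i j; fin_cases i <;> fin_cases j <;>
      simp only [Matrix.smul_apply, Matrix.mul_apply, Fin.sum_univ_two, smul_eq_mul,
        Matrix.of_apply, Matrix.cons_val', Matrix.cons_val_zero, Matrix.cons_val_one,
        Matrix.cons_val_fin_one, Fin.zero_eta, Fin.mk_one, Fin.isValue] <;>
      ring_nf <;> rw [hs] <;> ring

theorem mem_idealP {p : ℕ} {q : hurwitz} : q ∈ idealP p ↔ ∃ r : hurwitz, q = (p : hurwitz) * r := by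
  rw [idealP, Ideal.mem_span_singleton']
  exact ⟨fun ⟨a, ha⟩ => ⟨a, by rw [(Nat.cast_commute p a).eq, ha]⟩,
    fun ⟨a, ha⟩ => ⟨a, by rw [ha, (Nat.cast_commute p a).eq]⟩⟩

theorem mem_idealP_of_dvd {p : ℕ} (hp : Odd p) {q : hurwitz} (h0 : (p : ℤ) ∣ twoRe q)
    (h1 : (p : ℤ) ∣ twoImI q) (h2 : (p : ℤ) ∣ twoImJ q) (h3 : (p : ℤ) ∣ twoImK q) :
    q ∈ idealP p := by
  obtain ⟨a, ha⟩ := h0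
  obtain ⟨b, hb⟩ := h1
  obtain ⟨c, hc⟩ := h2
  obtain ⟨d, hd⟩ := h3
  obtain ⟨g1, g2, g3⟩ := two_dvd_sub_twoRe q
  rw [ha, hb] at g1
  rw [ha, hc] at g2
  rw [ha, hd] at g3
  have e0 := cast_twoRe q
  have e1 := cast_twoImI q
  have e2 := cast_twoImJ q
  have e3 := cast_twoImK q
  rw [ha] at e0
  rw [hb] at e1
  rw [hc] at e2
  rw [hd] at e3
  push_cast at e0 e1 e2 e3
  refine mem_idealP.2 ⟨⟨⟨a / 2, b / 2, c / 2, d / 2⟩, a, b, c, d,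
    two_dvd_sub_of_odd_mul hp g1, two_dvd_sub_of_odd_mul hp g2,
    two_dvd_sub_of_odd_mul hp g3, rfl, rfl, rfl, rfl⟩, Subtype.ext ?_⟩
  rw [Subring.coe_mul, Subring.coe_natCast, ← Quaternion.coe_natCast,
    Quaternion.coe_mul_eq_smul]
  ext
  · rw [Quaternion.re_smul, smul_eq_mul]; linarith
  · rw [Quaternion.imI_smul, smul_eq_mul]; linarith
  · rw [Quaternion.imJ_smul, smul_eq_mul]; linarith
  · rw [Quaternion.imK_smul, smul_eq_mul]; linarith

section toMat

variable {p : ℕ} [Fact p.Prime] {s t : ZMod p} (hst : s ^ 2 + t ^ 2 + 1 = 0)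
  (h2 : (2 : ZMod p) ≠ 0)

theorem toMat_apply (q : hurwitz) : toMat hst h2 q = (2 : ZMod p)⁻¹ •
    !![twoRe q + twoImJ q * s - twoImK q * t, -twoImI q + twoImJ q * t + twoImK q * s;
       twoImI q + twoImJ q * t + twoImK q * s, twoRe q - twoImJ q * s + twoImK q * t] := rfl

theorem toMat_surjective : Function.Surjective (toMat hst h2) := by
  intro m
  have hh : (2 : ZMod p)⁻¹ * 2 = 1 := inv_mul_cancel₀ h2
  have hlift : ∀ x : ZMod p, ∃ z : ℤ, (z : ZMod p) = x := ZMod.intCast_surjective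
  obtain ⟨a, ha⟩ := hlift ((2 : ZMod p)⁻¹ * (m 0 0 + m 1 1))
  obtain ⟨b, hb⟩ := hlift ((2 : ZMod p)⁻¹ * (m 1 0 - m 0 1))
  obtain ⟨c, hc⟩ := hlift (-(2 : ZMod p)⁻¹ * (s * (m 0 0 - m 1 1) + t * (m 0 1 + m 1 0)))
  obtain ⟨d, hd⟩ := hlift (-(2 : ZMod p)⁻¹ * (s * (m 0 1 + m 1 0) - t * (m 0 0 - m 1 1)))
  let q : hurwitz := ⟨⟨a, b, c, d⟩, 2 * a, 2 * b, 2 * c, 2 * d, by lia, by lia, by lia,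
    by simp, by simp, by simp, by simp⟩
  have h0 : twoRe q = 2 * a := by rify; rw [cast_twoRe]
  have h1 : twoImI q = 2 * b := by rify; rw [cast_twoImI]
  have h2' : twoImJ q = 2 * c := by rify; rw [cast_twoImJ]
  have h3 : twoImK q = 2 * d := by rify; rw [cast_twoImK]
  refine ⟨q, ?_⟩
  rw [toMat_apply, h0, h1, h2', h3]
  push_cast
  rw [ha, hb, hc, hd]
  generalize (2 : ZMod p)⁻¹ = h at *
  ext i j; fin_cases i <;> fin_cases j <;>
    simp only [Matrix.smul_apply, smul_eq_mul,
        Matrix.of_apply, Matrix.cons_val', Matrix.cons_val_zero, Matrix.cons_val_one,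
        Matrix.cons_val_fin_one, Fin.zero_eta, Fin.mk_one, Fin.isValue]
  · linear_combination m 0 0 * (1 + h * 2) * hh - h * 2 * h * (m 0 0 - m 1 1) * hst
  · linear_combination m 0 1 * (1 + h * 2) * hh - h * 2 * h * (m 0 1 + m 1 0) * hst
  · linear_combination m 1 0 * (1 + h * 2) * hh - h * 2 * h * (m 0 1 + m 1 0) * hst
  · linear_combination m 1 1 * (1 + h * 2) * hh + h * 2 * h * (m 0 0 - m 1 1) * hst

theorem toMat_eq_zero (hp : Odd p) {q : hurwitz} (hq : toMat hst h2 q = 0) : q ∈ idealP p := by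
  have hinv : (2 : ZMod p)⁻¹ ≠ 0 := inv_ne_zero h2
  rw [toMat_apply, smul_eq_zero] at hq
  replace hq := hq.resolve_left hinv
  have e00 := congrFun (congrFun hq 0) 0
  have e01 := congrFun (congrFun hq 0) 1
  have e10 := congrFun (congrFun hq 1) 0
  have e11 := congrFun (congrFun hq 1) 1
  simp only [Matrix.of_apply, Matrix.cons_val', Matrix.cons_val_zero, Matrix.cons_val_one,
    Matrix.cons_val_fin_one, Matrix.zero_apply] at e00 e01 e10 e11
  have cancel : ∀ x : ZMod p, 2 * x = 0 → x = 0 := fun x hx => (mul_eq_zero.1 hx).resolve_left h2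
  refine mem_idealP_of_dvd hp ?_ ?_ ?_ ?_ <;> rw [← ZMod.intCast_zmod_eq_zero_iff_dvd] <;>
    apply cancel
  · linear_combination e00 + e11
  · linear_combination e10 - e01
  · linear_combination -s * (e00 - e11) - t * (e01 + e10) + 2 * (twoImJ q : ZMod p) * hst
  · linear_combination t * (e00 - e11) - s * (e01 + e10) + 2 * (twoImK q : ZMod p) * hst

end toMat

theorem nonempty_quotient_ringEquiv {p : ℕ} (hp : p.Prime) (hodd : Odd p) :
    Nonempty (hurwitz ⧸ idealP p ≃+* Mat p) := by
  have : Fact p.Prime := ⟨hp⟩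
  obtain ⟨s, t, hst⟩ := ZMod.sq_add_sq p (-1)
  replace hst : s ^ 2 + t ^ 2 + 1 = 0 := by rw [hst]; ring
  have h2 : (2 : ZMod p) ≠ 0 := by
    intro h
    have h' : ((2 : ℕ) : ZMod p) = 0 := by exact_mod_cast h
    rw [ZMod.natCast_eq_zero_iff] at h'
    obtain rfl := (Nat.prime_dvd_prime_iff_eq hp Nat.prime_two).1 h'
    revert hodd
    decide
  refine ⟨RingEquiv.ofBijective (Ideal.Quotient.lift (idealP p) (toMat hst h2) fun q hq => ?_)
    ⟨?_, Ideal.Quotient.lift_surjective_of_surjective _ _ (toMat_surjective hst h2)⟩⟩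
  · obtain ⟨r, rfl⟩ := mem_idealP.1 hq
    rw [map_mul, map_natCast]
    have : ((p : ℕ) : Mat p) = 0 := CharP.cast_eq_zero _ _
    rw [this, zero_mul]
  · rw [injective_iff_map_eq_zero]
    intro x hx
    obtain ⟨q, rfl⟩ := Ideal.Quotient.mk_surjective x
    rw [Ideal.Quotient.lift_mk] at hx
    exact Ideal.Quotient.eq_zero_iff_mem.2 (toMat_eq_zero hst h2 hodd hx)

/-- A nonzero Hurwitz integer that is not invertible modulo `p` has norm divisible by `p`. -/
theorem le_norm_sq_of_not_isUnit {p : ℕ} (hp : p.Prime) {q : hurwitz} (hq0 : q ≠ 0)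
    (hq : ¬ IsUnit (Ideal.Quotient.mk (idealP p) q)) : (p : ℝ) ≤ ‖(q : ℍ[ℝ])‖ ^ 2 := by
  have hdvd : p ∣ sqNorm q := by
    by_contra hnd
    have hcop : IsCoprime (p : ℤ) (sqNorm q : ℤ) :=
      Nat.isCoprime_iff_coprime.2 ((hp.coprime_iff_not_dvd).2 hnd)
    obtain ⟨u, v, huv⟩ := hcop
    have hstar : (⟨star (q : ℍ[ℝ]), star_mem_hurwitz q.2⟩ : hurwitz) * q = (sqNorm q : hurwitz) :=
      Subtype.ext (by
        rw [Subring.coe_mul, Quaternion.star_mul_self, normSq_eq_sqNorm]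
        rfl)
    have hstar' : q * (⟨star (q : ℍ[ℝ]), star_mem_hurwitz q.2⟩ : hurwitz) = (sqNorm q : hurwitz) :=
      Subtype.ext (by
        rw [Subring.coe_mul, Quaternion.self_mul_star, normSq_eq_sqNorm]
        rfl)
    have hone : Ideal.Quotient.mk (idealP p) ((v : hurwitz) * (sqNorm q : hurwitz)) = 1 := by
      rw [← map_one (Ideal.Quotient.mk (idealP p)), Ideal.Quotient.eq]
      refine mem_idealP.2 ⟨-u, ?_⟩
      have := congrArg (Int.cast : ℤ → hurwitz) huv
      push_cast at this
      rw [← this, (Int.cast_commute u (p : hurwitz)).eq, mul_neg]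
      abel
    refine hq (isUnit_iff_exists_and_exists.2 ⟨⟨Ideal.Quotient.mk (idealP p)
      (⟨star (q : ℍ[ℝ]), star_mem_hurwitz q.2⟩ * (v : hurwitz)), ?_⟩,
      ⟨Ideal.Quotient.mk (idealP p) ((v : hurwitz) * ⟨star (q : ℍ[ℝ]), star_mem_hurwitz q.2⟩), ?_⟩⟩)
    · rw [← map_mul, ← mul_assoc, hstar', (Nat.cast_commute (sqNorm q) (v : hurwitz)).eq, hone]
    · rw [← map_mul, mul_assoc, hstar, hone]
  have hpos : 0 < sqNorm q := by
    have : 0 < ‖(q : ℍ[ℝ])‖ ^ 2 := by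
      have : (q : ℍ[ℝ]) ≠ 0 := fun h => hq0 (Subtype.ext h)
      positivity
    rw [norm_sq_eq_sqNorm] at this
    exact_mod_cast this
  rw [norm_sq_eq_sqNorm]
  exact_mod_cast Nat.le_of_dvd hpos hdvd

/-! ### The lattice of Hurwitz vectors -/

theorem norm_sq_hspace {t : ℕ} (v : HSpace t) : ‖v‖ ^ 2 = ∑ i, ‖v i‖ ^ 2 :=
  PiLp.norm_sq_eq_of_L2 _ v

theorem norm_apply_le {t : ℕ} (v : HSpace t) (i : Fin t) : ‖v i‖ ≤ ‖v‖ :=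
  PiLp.norm_apply_le v i

theorem norm_le_sqrt_of_forall {t : ℕ} {v : HSpace t} (h : ∀ i, ‖v i‖ ≤ 1) : ‖v‖ ≤ √t := by
  refine Real.le_sqrt_of_sq_le ?_
  rw [norm_sq_hspace]
  calc ∑ i, ‖v i‖ ^ 2 ≤ ∑ _i : Fin t, (1 : ℝ) :=
        Finset.sum_le_sum fun i _ => pow_le_one₀ (norm_nonneg _) (h i)
    _ = t := by simp

theorem finrank_hspace (t : ℕ) : Module.finrank ℝ (HSpace t) = 4 * t := by
  rw [(WithLp.linearEquiv 2 ℝ (Fin t → ℍ[ℝ])).finrank_eq, Module.finrank_pi_fintype]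
  simp [Quaternion.finrank_eq_four, mul_comm]

@[simp]
theorem inclusion_apply {t : ℕ} (x : Fin t → hurwitz) (i : Fin t) :
    inclusion x i = (x i : ℍ[ℝ]) := rfl

theorem inclusion_injective {t : ℕ} : Function.Injective (inclusion (t := t)) := fun _ _ h =>
  funext fun i => Subtype.ext (congrFun (congrArg WithLp.ofLp h) i)

theorem inclusion_sub {t : ℕ} (x y : Fin t → hurwitz) :
    inclusion (x - y) = inclusion x - inclusion y := rfl

theorem inclusion_zero {t : ℕ} : inclusion (0 : Fin t → hurwitz) = 0 := rfl

theorem one_le_norm_hurwitz {q : hurwitz} (hq : q ≠ 0) : 1 ≤ ‖(q : ℍ[ℝ])‖ := by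
  have hpos : 0 < ‖(q : ℍ[ℝ])‖ ^ 2 := by
    have : (q : ℍ[ℝ]) ≠ 0 := fun h => hq (Subtype.ext h)
    positivity
  have h1 : (1 : ℝ) ≤ ‖(q : ℍ[ℝ])‖ ^ 2 := by
    rw [norm_sq_eq_sqNorm] at hpos ⊢
    exact_mod_cast hpos
  nlinarith [norm_nonneg (q : ℍ[ℝ])]

theorem one_le_norm_inclusion {t : ℕ} {x : Fin t → hurwitz} (hx : x ≠ 0) :
    1 ≤ ‖inclusion x‖ := by
  obtain ⟨i, hi⟩ := Function.ne_iff.1 hx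
  exact (one_le_norm_hurwitz hi).trans (norm_apply_le (inclusion x) i)

theorem exists_inclusion_norm_sub_le {t : ℕ} (v : HSpace t) :
    ∃ x : Fin t → hurwitz, ‖v - inclusion x‖ ≤ √t := by
  choose x hx using fun i => exists_hurwitz_norm_sub_lt (v i)
  exact ⟨x, norm_le_sqrt_of_forall fun i => (hx i).le⟩

theorem mem_hurwitzLattice {t : ℕ} {v : HSpace t} :
    v ∈ hurwitzLattice t ↔ ∃ x, inclusion x = v :=
  ⟨fun h => ⟨fun i => ⟨v i, h i⟩, rfl⟩, by rintro ⟨x, rfl⟩ i; exact (x i).2⟩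

/-- A subspace at bounded distance from every vector is the whole space. -/
theorem eq_top_of_bounded_distance {E : Type*} [NormedAddCommGroup E] [NormedSpace ℝ E]
    [FiniteDimensional ℝ E] (W : Submodule ℝ E) (C : ℝ) (h : ∀ v, ∃ w ∈ W, ‖v - w‖ ≤ C) :
    W = ⊤ := by
  refine (Submodule.eq_top_iff').2 fun v => ?_
  have hcl : IsClosed (W : Set E) := W.closed_of_finiteDimensional
  rw [← SetLike.mem_coe, ← hcl.closure_eq, Metric.mem_closure_iff]
  intro δ hδ
  obtain ⟨n, hn⟩ := exists_nat_gt (C / δ)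
  have hC : 0 ≤ C := by
    obtain ⟨w, -, hw⟩ := h 0
    exact (norm_nonneg _).trans hw
  have hn0 : (0 : ℝ) < n := lt_of_le_of_lt (by positivity) hn
  obtain ⟨w, hw, hvw⟩ := h ((n : ℝ) • v)
  refine ⟨(n : ℝ)⁻¹ • w, W.smul_mem _ hw, ?_⟩
  have he : v - (n : ℝ)⁻¹ • w = (n : ℝ)⁻¹ • ((n : ℝ) • v - w) := by
    rw [smul_sub, inv_smul_smul₀ hn0.ne']
  rw [dist_eq_norm, he, norm_smul, norm_inv, Real.norm_of_nonneg hn0.le, inv_mul_lt_iff₀ hn0]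
  rw [div_lt_iff₀ hδ] at hn
  linarith

instance (t : ℕ) : DiscreteTopology (hurwitzLattice t) := by
  refine DiscreteTopology.of_forall_le_norm (r := 1) one_pos fun v hv => ?_
  obtain ⟨x, hx⟩ := mem_hurwitzLattice.1 v.2
  change 1 ≤ ‖(v : HSpace t)‖
  rw [← hx]
  exact one_le_norm_inclusion (by
    rintro rfl
    exact hv (Subtype.ext hx.symm))

instance (t : ℕ) : IsZLattice ℝ (hurwitzLattice t) where
  span_top := eq_top_of_bounded_distance _ √t fun v => by
    obtain ⟨x, hx⟩ := exists_inclusion_norm_sub_le v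
    exact ⟨_, Submodule.subset_span (mem_hurwitzLattice.2 ⟨x, rfl⟩), hx⟩

/-- A box in `ℍ` that is a fundamental domain for the Hurwitz integers, which contain `ℤ⁴` with
index `2`. -/
def fundamentalBox : Set ℍ[ℝ] :=
  {q | q.re ∈ Set.Ico (-1 / 4) (1 / 4) ∧ q.imI ∈ Set.Ico (-1 / 2) (1 / 2) ∧
    q.imJ ∈ Set.Ico (-1 / 2) (1 / 2) ∧ q.imK ∈ Set.Ico (-1 / 2) (1 / 2)}

theorem exists_add_mem_fundamentalBox (q : ℍ[ℝ]) :
    ∃ h : hurwitz, (h : ℍ[ℝ]) + q ∈ fundamentalBox := by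
  let n : ℤ := -⌊2 * q.re + 1 / 2⌋
  have hround : ∀ x : ℝ, ∃ m : ℤ, (n : ℝ) / 2 + m + x ∈ Set.Ico (-1 / 2 : ℝ) (1 / 2) := by
    intro x
    refine ⟨-⌊(n : ℝ) / 2 + x + 1 / 2⌋, ?_, ?_⟩
    · have := Int.floor_le ((n : ℝ) / 2 + x + 1 / 2)
      push_cast
      linarith
    · have := Int.lt_floor_add_one ((n : ℝ) / 2 + x + 1 / 2)
      push_cast
      linarith
  obtain ⟨b, hb⟩ := hround q.imI
  obtain ⟨c, hc⟩ := hround q.imJ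
  obtain ⟨d, hd⟩ := hround q.imK
  refine ⟨⟨⟨n / 2, n / 2 + b, n / 2 + c, n / 2 + d⟩, n, n + 2 * b, n + 2 * c, n + 2 * d,
    by simp, by simp, by simp, rfl, by push_cast; ring, by push_cast; ring, by push_cast; ring⟩,
    ⟨?_, ?_⟩, hb, hc, hd⟩
  · change (-1 / 4 : ℝ) ≤ n / 2 + q.re
    have := Int.floor_le (2 * q.re + 1 / 2)
    simp only [n]
    push_cast
    linarith
  · change n / 2 + q.re < (1 / 4 : ℝ)
    have := Int.lt_floor_add_one (2 * q.re + 1 / 2)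
    simp only [n]
    push_cast
    linarith

theorem eq_of_add_mem_fundamentalBox {q : ℍ[ℝ]} {g h : hurwitz}
    (hg : (g : ℍ[ℝ]) + q ∈ fundamentalBox) (hh : (h : ℍ[ℝ]) + q ∈ fundamentalBox) : g = h := by
  obtain ⟨a, b, c, d, hab, hac, had, e0, e1, e2, e3⟩ := (g - h).2
  simp only [AddSubgroupClass.coe_sub, Quaternion.re_sub, Quaternion.imI_sub, Quaternion.imJ_sub,
    Quaternion.imK_sub] at e0 e1 e2 e3
  simp only [fundamentalBox, Set.mem_ofPred_eq, Quaternion.re_add, Quaternion.imI_add,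
    Quaternion.imJ_add, Quaternion.imK_add, Set.mem_Ico] at hg hh
  have ha : a = 0 := by
    have h1 : (a : ℝ) < 1 := by linarith
    have h2 : (-1 : ℝ) < a := by linarith
    have h1 : a < 1 := by exact_mod_cast h1
    have h2 : -1 < a := by exact_mod_cast h2
    lia
  have small : ∀ m : ℤ, 2 ∣ m - a → (m : ℝ) < 2 → (-2 : ℝ) < m → m = 0 := by
    intro m hm h1 h2
    have h1 : m < 2 := by exact_mod_cast h1
    have h2 : -2 < m := by exact_mod_cast h2
    lia
  have hb := small b hab (by linarith) (by linarith)
  have hc := small c hac (by linarith) (by linarith)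
  have hd := small d had (by linarith) (by linarith)
  subst ha hb hc hd
  simp only [Int.cast_zero, zero_div] at e0 e1 e2 e3
  refine Subtype.ext ?_
  ext <;> linarith

theorem norm_le_one_of_mem_fundamentalBox {q : ℍ[ℝ]} (hq : q ∈ fundamentalBox) : ‖q‖ ≤ 1 := by
  obtain ⟨⟨h1, h2⟩, ⟨h3, h4⟩, ⟨h5, h6⟩, h7, h8⟩ := hq
  have : ‖q‖ ^ 2 ≤ 1 := by
    rw [sq, ← Quaternion.normSq_eq_norm_mul_self, normSq_eq]
    nlinarith
  nlinarith [norm_nonneg q]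

/-- The product of the boxes `fundamentalBox`, a fundamental domain for the lattice of Hurwitz
vectors. -/
def fundamentalBoxes (t : ℕ) : Set (HSpace t) := {v | ∀ i, v i ∈ fundamentalBox}

theorem measurableSet_fundamentalBoxes (t : ℕ) : MeasurableSet (fundamentalBoxes t) := by
  have hc : ∀ i : Fin t, Continuous fun v : HSpace t => v i := fun i => by fun_prop
  have hm : ∀ (i : Fin t) (f : ℍ[ℝ] → ℝ), Continuous f → ∀ a b : ℝ,
      MeasurableSet {v : HSpace t | f (v i) ∈ Set.Ico a b} := fun i f hf a b =>
    (hf.comp (hc i)).measurable measurableSet_Ico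
  have hi : fundamentalBoxes t = ⋂ i, {v : HSpace t | v i ∈ fundamentalBox} := by
    ext v
    simp [fundamentalBoxes]
  rw [hi]
  refine MeasurableSet.iInter fun i => ?_
  exact (hm i _ Quaternion.continuous_re _ _).inter ((hm i _ Quaternion.continuous_imI _ _).inter
    ((hm i _ Quaternion.continuous_imJ _ _).inter (hm i _ Quaternion.continuous_imK _ _)))

theorem eq_of_inclusion_add_mem_fundamentalBoxes {t : ℕ} {v : HSpace t} {x y : Fin t → hurwitz}
    (hx : inclusion x + v ∈ fundamentalBoxes t) (hy : inclusion y + v ∈ fundamentalBoxes t) :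
    x = y :=
  funext fun i => eq_of_add_mem_fundamentalBox (hx i) (hy i)

theorem hurwitzCovolume_eq (t : ℕ) : hurwitzCovolume t = volume.real (fundamentalBoxes t) := by
  refine ZLattice.covolume_eq_measure_fundamentalDomain _ _
    (IsAddFundamentalDomain.mk' (measurableSet_fundamentalBoxes t).nullMeasurableSet fun v => ?_)
  choose x hx using fun i => exists_add_mem_fundamentalBox (v i)
  refine ⟨⟨inclusion x, mem_hurwitzLattice.2 ⟨x, rfl⟩⟩, hx, ?_⟩
  rintro ⟨g, hg⟩ hgv
  obtain ⟨y, rfl⟩ := mem_hurwitzLattice.1 hg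
  have : y = x := eq_of_inclusion_add_mem_fundamentalBoxes (v := v) hgv hx
  subst this
  rfl

theorem hurwitzCovolume_pos (t : ℕ) : 0 < hurwitzCovolume t := ZLattice.covolume_pos _ _

theorem fundamentalBoxes_subset (t : ℕ) : fundamentalBoxes t ⊆ Metric.closedBall 0 √t :=
  fun v hv => by
    rw [mem_closedBall_zero_iff]
    exact norm_le_sqrt_of_forall fun i => norm_le_one_of_mem_fundamentalBox (hv i)

/-- The orthonormal basis of `ℍ^t` formed by the vectors with one coordinate in `{1, i, j, k}` and
all others zero. -/
def coordBasis (t : ℕ) : OrthonormalBasis (Fin t × Fin 4) ℝ (HSpace t) :=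
  (Pi.orthonormalBasis fun _ : Fin t =>
    OrthonormalBasis.ofRepr Quaternion.linearIsometryEquivTuple).reindex
    (Equiv.sigmaEquivProd _ _)

theorem coordBasis_repr (t : ℕ) (v : HSpace t) (i : Fin t) (k : Fin 4) :
    (coordBasis t).repr v (i, k) = ![(v i).re, (v i).imI, (v i).imJ, (v i).imK] k := by
  rfl

open scoped Pointwise in
/-- A crude lower bound for the covolume (which is `2⁻ᵗ`): the box `fundamentalBoxes t` contains
a cube of side `1 / 8`. -/
theorem inv_eight_pow_le_hurwitzCovolume (t : ℕ) : (8⁻¹ : ℝ) ^ (4 * t) ≤ hurwitzCovolume t := by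
  have hsub : (8⁻¹ : ℝ) • parallelepiped (coordBasis t) ⊆ fundamentalBoxes t := by
    rintro _ ⟨w, hw, rfl⟩ i
    obtain ⟨c, ⟨hc0, hc1⟩, rfl⟩ := (mem_parallelepiped_iff _ _).1 hw
    set w := ∑ j, c j • coordBasis t j with hwdef
    have hrepr : ∀ j, (coordBasis t).repr w j = c j := fun j => by
      rw [hwdef, OrthonormalBasis.repr_apply_apply, Orthonormal.inner_right_fintype]
      exact (coordBasis t).orthonormal
    have h0 : (w i).re = c (i, 0) := by rw [← hrepr, coordBasis_repr]; rfl
    have h1 : (w i).imI = c (i, 1) := by rw [← hrepr, coordBasis_repr]; rfl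
    have h2 : (w i).imJ = c (i, 2) := by rw [← hrepr, coordBasis_repr]; rfl
    have h3 : (w i).imK = c (i, 3) := by rw [← hrepr, coordBasis_repr]; rfl
    have hc0' : ∀ j, 0 ≤ c j := hc0
    have hc1' : ∀ j, c j ≤ 1 := hc1
    change (8⁻¹ : ℝ) • w i ∈ fundamentalBox
    simp only [fundamentalBox, Set.mem_ofPred_eq, Quaternion.re_smul, Quaternion.imI_smul,
      Quaternion.imJ_smul, Quaternion.imK_smul, h0, h1, h2, h3, smul_eq_mul, Set.mem_Ico]
    refine ⟨⟨?_, ?_⟩, ⟨?_, ?_⟩, ⟨?_, ?_⟩, ?_, ?_⟩ <;>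
      linarith [hc0' (i, 0), hc1' (i, 0), hc0' (i, 1), hc1' (i, 1), hc0' (i, 2), hc1' (i, 2),
        hc0' (i, 3), hc1' (i, 3)]
  have hfin : volume (fundamentalBoxes t) ≠ ⊤ :=
    measure_ne_top_of_subset (fundamentalBoxes_subset t) measure_closedBall_lt_top.ne
  have := measureReal_mono hsub hfin
  rw [hurwitzCovolume_eq]
  refine le_trans (le_of_eq ?_) this
  rw [measureReal_def, Measure.addHaar_smul, OrthonormalBasis.volume_parallelepiped,
    finrank_hspace, mul_one, ENNReal.toReal_ofReal (abs_nonneg _), abs_of_nonneg (by positivity)]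

/-! ### Volumes and lattice points in balls -/

/-- The volume of the unit ball of `ℍ^t`. -/
def unitBallVolume (t : ℕ) : ℝ := Real.pi ^ (2 * t) / (2 * t).factorial

theorem unitBallVolume_pos (t : ℕ) : 0 < unitBallVolume t := by
  unfold unitBallVolume
  have := Real.pi_pos
  positivity

theorem volume_closedBall_hspace {t : ℕ} (ht : 0 < t) (v : HSpace t) {r : ℝ} (hr : 0 ≤ r) :
    volume (Metric.closedBall v r) = ENNReal.ofReal (r ^ (4 * t) * unitBallVolume t) := by
  have : Nontrivial (HSpace t) :=
    Module.nontrivial_of_finrank_pos (R := ℝ) (by rw [finrank_hspace]; lia)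
  rw [InnerProductSpace.volume_closedBall_of_dim_even (k := 2 * t)
    (by rw [finrank_hspace]; ring), finrank_hspace, ENNReal.ofReal_mul (by positivity),
    ENNReal.ofReal_pow hr]
  rfl

theorem volumeReal_closedBall {t : ℕ} (ht : 0 < t) (v : HSpace t) {r : ℝ} (hr : 0 ≤ r) :
    volume.real (Metric.closedBall v r) = r ^ (4 * t) * unitBallVolume t := by
  have := unitBallVolume_pos t
  rw [measureReal_def, volume_closedBall_hspace ht v hr, ENNReal.toReal_ofReal (by positivity)]

theorem volumeReal_ball {t : ℕ} (ht : 0 < t) (v : HSpace t) {r : ℝ} (hr : 0 ≤ r) :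
    volume.real (Metric.ball v r) = r ^ (4 * t) * unitBallVolume t := by
  have : Nontrivial (HSpace t) :=
    Module.nontrivial_of_finrank_pos (R := ℝ) (by rw [finrank_hspace]; lia)
  rw [← volumeReal_closedBall ht v hr, measureReal_def, measureReal_def,
    Measure.addHaar_closedBall_eq_addHaar_ball]

/-- If the translates of `A ⊆ B(d)` by the points of a finite subset of `B(R)` are disjoint, they
all fit into `B(R + d)`. -/
theorem card_mul_volumeReal_le {t : ℕ} (ht : 0 < t) (S : Finset (HSpace t)) {A : Set (HSpace t)}
    (hA : MeasurableSet A) {R d : ℝ} (hR : 0 ≤ R) (hd : 0 ≤ d)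
    (hAd : A ⊆ Metric.closedBall 0 d) (hS : ∀ x ∈ S, ‖x‖ ≤ R)
    (hdis : ∀ x ∈ S, ∀ y ∈ S, ∀ a ∈ A, ∀ b ∈ A, x + a = y + b → x = y) :
    S.card * volume.real A ≤ (R + d) ^ (4 * t) * unitBallVolume t := by
  have hfin : ∀ x ∈ S, volume ((fun a => x + a) '' A) ≠ ⊤ := fun x _ => by
    rw [Set.image_add_left, measure_preimage_add]
    exact measure_ne_top_of_subset hAd measure_closedBall_lt_top.ne
  have hmeas : ∀ x ∈ S, MeasurableSet ((fun a => x + a) '' A) := fun x _ => by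
    rw [Set.image_add_left]
    exact measurable_const_add _ hA
  have hsum : volume.real (⋃ x ∈ S, (fun a => x + a) '' A) = S.card * volume.real A := by
    rw [measureReal_biUnion_finset ?_ hmeas hfin]
    · rw [← nsmul_eq_mul, ← Finset.sum_const]
      refine Finset.sum_congr rfl fun x _ => ?_
      rw [measureReal_def, Set.image_add_left, measure_preimage_add, measureReal_def]
    · intro x hx y hy hxy
      refine Set.disjoint_left.2 ?_
      rintro _ ⟨a, ha, rfl⟩ ⟨b, hb, hab⟩
      exact hxy (hdis x hx y hy a ha b hb hab.symm)
  rw [← hsum, ← volumeReal_closedBall ht 0 (by positivity : 0 ≤ R + d)]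
  refine measureReal_mono ?_ measure_closedBall_lt_top.ne
  refine Set.iUnion₂_subset fun x hx => ?_
  rintro _ ⟨a, ha, rfl⟩
  rw [mem_closedBall_zero_iff]
  exact (norm_add_le _ _).trans (add_le_add (hS x hx) (mem_closedBall_zero_iff.1 (hAd ha)))

/-- The number of Hurwitz vectors in a ball of radius `R`, up to the covering radius `√t`. -/
theorem card_hurwitz_le {t : ℕ} (ht : 0 < t) (S : Finset (Fin t → hurwitz)) {R : ℝ} (hR : 0 ≤ R)
    (hS : ∀ x ∈ S, ‖inclusion x‖ ≤ R) :
    S.card * hurwitzCovolume t ≤ (R + √t) ^ (4 * t) * unitBallVolume t := by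
  rw [hurwitzCovolume_eq, ← Finset.card_map ⟨inclusion, inclusion_injective⟩]
  refine card_mul_volumeReal_le ht _ (measurableSet_fundamentalBoxes t) hR (Real.sqrt_nonneg _)
    (fundamentalBoxes_subset t) ?_ ?_
  · intro v hv
    obtain ⟨x, hx, rfl⟩ := Finset.mem_map.1 hv
    exact hS x hx
  · intro v hv w hw a ha b hb hab
    obtain ⟨x, hx, rfl⟩ := Finset.mem_map.1 hv
    obtain ⟨y, hy, rfl⟩ := Finset.mem_map.1 hw
    simp only [Function.Embedding.coeFn_mk] at hab ⊢
    have : x - y = 0 := eq_of_inclusion_add_mem_fundamentalBoxes (v := a)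
      (by rwa [inclusion_sub, sub_add_eq_add_sub, hab, add_sub_cancel_left])
      (by rwa [inclusion_zero, zero_add])
    rw [sub_eq_zero.1 this]

/-- Packing bound: the number of points with mutual distances at least `δ` in a ball of radius
`R`. -/
theorem card_le_of_separated {t : ℕ} (ht : 0 < t) (S : Finset (HSpace t)) {R δ : ℝ} (hR : 0 ≤ R)
    (hδ : 0 < δ) (hS : ∀ x ∈ S, ‖x‖ ≤ R)
    (hsep : ∀ x ∈ S, ∀ y ∈ S, x ≠ y → δ ≤ ‖x - y‖) :
    (S.card : ℝ) ≤ (2 * R / δ + 1) ^ (4 * t) := by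
  have h := card_mul_volumeReal_le ht S (A := Metric.ball 0 (δ / 2)) measurableSet_ball hR
    (by positivity : 0 ≤ δ / 2) Metric.ball_subset_closedBall hS ?_
  · rw [volumeReal_ball ht 0 (by positivity), ← mul_assoc] at h
    have h' := le_of_mul_le_mul_right h (unitBallVolume_pos t)
    have he : R + δ / 2 = (2 * R / δ + 1) * (δ / 2) := by field_simp
    rw [he, mul_pow] at h'
    exact le_of_mul_le_mul_right h' (by positivity)
  · intro x hx y hy a ha b hb hab
    by_contra hxy
    have h1 := hsep x hx y hy hxy
    have he : x - y = b - a := by rw [sub_eq_sub_iff_add_eq_add, hab, add_comm]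
    rw [he] at h1
    rw [mem_ball_zero_iff] at ha hb
    linarith [norm_sub_le b a]

/-! ### A family of codes in which every word is rare -/

theorem card_fiber_mul_card_of_surjective {G H : Type*} [AddGroup G] [AddGroup H] [Fintype G]
    [Fintype H] [DecidableEq H] (f : G →+ H) (hf : Function.Surjective f) (h : H) :
    (Finset.univ.filter fun g => f g = h).card * Fintype.card H = Fintype.card G := by
  have hc : ∀ h', (Finset.univ.filter fun g => f g = h').card =
      (Finset.univ.filter fun g => f g = h).card := fun h' =>
    AddMonoidHom.card_fiber_eq_of_mem_range f (hf h') (hf h)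
  have := Finset.card_eq_sum_card_fiberwise (f := f) (s := Finset.univ) (t := Finset.univ)
    (fun _ _ => Finset.mem_coe.2 (Finset.mem_univ _))
  rw [Finset.sum_congr rfl fun h' _ => hc h', Finset.sum_const, smul_eq_mul, mul_comm,
    Finset.card_univ] at this
  rw [this, Finset.card_univ]

/-- Among the linear maps `F^K → F^L`, those whose graphs contain `m` given linearly independent
vectors make up a proportion of at most `|F|⁻ᵐᴸ`. -/
theorem card_graph_mul_le {F K L : Type*} [Field F] [Fintype F] [DecidableEq F] [Fintype K]
    [DecidableEq K] [Fintype L] [DecidableEq L] {m : ℕ} (u : Fin m → K → F) (w : Fin m → L → F)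
    (h : LinearIndependent F fun a => (u a, w a)) :
    (Finset.univ.filter fun B : Matrix L K F => ∀ a, B.mulVec (u a) = w a).card *
      Fintype.card F ^ (m * Fintype.card L) ≤ Fintype.card (Matrix L K F) := by
  rcases Finset.eq_empty_or_nonempty
    (Finset.univ.filter fun B : Matrix L K F => ∀ a, B.mulVec (u a) = w a) with h0 | ⟨B, hB⟩
  · simp [h0]
  have hB : ∀ a, B.mulVec (u a) = w a := (Finset.mem_filter.1 hB).2
  -- the graph of `B` is isomorphic to its domain, so the vectors `u a` are independent as well
  have hu : LinearIndependent F u := by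
    refine LinearIndependent.of_comp (LinearMap.prod LinearMap.id B.mulVecLin) ?_
    have : (LinearMap.prod LinearMap.id B.mulVecLin) ∘ u = fun a => (u a, w a) :=
      funext fun a => Prod.ext rfl (hB a)
    rwa [this]
  let Φ : Matrix L K F →+ (Fin m → L → F) :=
    { toFun := fun B a => B.mulVec (u a)
      map_zero' := by ext; simp
      map_add' := fun B B' => by ext; simp [Matrix.add_mulVec] }
  have hΦ : Function.Surjective Φ := by
    intro w'
    obtain ⟨g, hg⟩ := (Fintype.linearCombination F u).exists_leftInverse_of_injective
      (LinearMap.ker_eq_bot.2 hu.fintypeLinearCombination_injective)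
    refine ⟨LinearMap.toMatrix' (Fintype.linearCombination F w' ∘ₗ g), funext fun a => ?_⟩
    change (LinearMap.toMatrix' (Fintype.linearCombination F w' ∘ₗ g)).mulVec (u a) = w' a
    rw [LinearMap.toMatrix'_mulVec, LinearMap.comp_apply]
    have hua : u a = Fintype.linearCombination F u (Pi.single a 1) := by
      rw [Fintype.linearCombination_apply_single, one_smul]
    have hga : g (u a) = Pi.single a 1 := by
      rw [hua]
      exact LinearMap.congr_fun hg _
    rw [hga, Fintype.linearCombination_apply_single, one_smul]
  have hcard := card_fiber_mul_card_of_surjective Φ hΦ w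
  have hset : (Finset.univ.filter fun B : Matrix L K F => ∀ a, B.mulVec (u a) = w a) =
      Finset.univ.filter fun B => Φ B = w := by
    ext B
    simp only [Finset.mem_filter, Finset.mem_univ, true_and]
    exact ⟨fun h => funext h, fun h a => congrFun h a⟩
  rw [hset, ← hcard]
  refine le_of_eq ?_
  congr 1
  rw [Fintype.card_fun, Fintype.card_fun, Fintype.card_fin, ← pow_mul, mul_comm]

section Codes

variable {p t : ℕ}

/-- A row of the `2 × 2t` matrix formed by `t` matrices of size `2 × 2`. -/
def row (X : Fin t → Mat p) (a : Fin 2) : Fin t × Fin 2 → ZMod p := fun j => X j.1 a j.2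

theorem row_smul (M : Mat p) (X : Fin t → Mat p) (a : Fin 2) (j : Fin t × Fin 2) :
    row (M • X) a j = ∑ c, M a c * row X c j := by
  simp [row, Matrix.mul_apply]

theorem row_injective : Function.Injective (row (p := p) (t := t)) := fun X Y h => by
  funext j
  ext a b
  exact congrFun (congrFun h a) (j, b)

variable (σ : Fin t × Fin 2 ≃ Fin (t + 1) ⊕ Fin (t - 1))

/-- The first `t + 1` entries of a row, in the order given by `σ`. -/
def rowHead (X : Fin t → Mat p) (a : Fin 2) : Fin (t + 1) → ZMod p :=
  fun k => row X a (σ.symm (Sum.inl k))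

/-- The last `t - 1` entries of a row, in the order given by `σ`. -/
def rowTail (X : Fin t → Mat p) (a : Fin 2) : Fin (t - 1) → ZMod p :=
  fun l => row X a (σ.symm (Sum.inr l))

/-- The code of all `2 × 2t` matrices whose rows lie in the graph of the linear map
`𝔽_p^(t+1) → 𝔽_p^(t-1)` with matrix `B`. -/
def graphCode (B : Matrix (Fin (t - 1)) (Fin (t + 1)) (ZMod p)) :
    Submodule (Mat p) (Fin t → Mat p) where
  carrier := {X | ∀ a, B.mulVec (rowHead σ X a) = rowTail σ X a}
  add_mem' {X Y} hX hY a := by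
    have h1 : rowHead σ (X + Y) a = rowHead σ X a + rowHead σ Y a := rfl
    have h2 : rowTail σ (X + Y) a = rowTail σ X a + rowTail σ Y a := rfl
    rw [h1, h2, Matrix.mulVec_add, hX a, hY a]
  zero_mem' a := by
    have h1 : rowHead σ (0 : Fin t → Mat p) a = 0 := rfl
    have h2 : rowTail σ (0 : Fin t → Mat p) a = 0 := rfl
    rw [h1, h2, Matrix.mulVec_zero]
  smul_mem' M X hX a := by
    have h1 : rowHead σ (M • X) a = ∑ c, M a c • rowHead σ X c := by
      ext k; simp [rowHead, row_smul]
    have h2 : rowTail σ (M • X) a = ∑ c, M a c • rowTail σ X c := by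
      ext k; simp [rowTail, row_smul]
    rw [h1, h2, Matrix.mulVec_sum]
    exact Finset.sum_congr rfl fun c _ => by rw [Matrix.mulVec_smul, hX c]

theorem mem_graphCode {B : Matrix (Fin (t - 1)) (Fin (t + 1)) (ZMod p)} {X : Fin t → Mat p} :
    X ∈ graphCode σ B ↔ ∀ a, B.mulVec (rowHead σ X a) = rowTail σ X a := Iff.rfl

theorem eq_of_rowHead_rowTail {X Y : Fin t → Mat p} (h1 : ∀ a, rowHead σ X a = rowHead σ Y a)
    (h2 : ∀ a, rowTail σ X a = rowTail σ Y a) : X = Y := by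
  refine row_injective (funext fun a => funext fun j => ?_)
  rcases hj : σ j with k | l
  · have := congrFun (h1 a) k
    rwa [rowHead, rowHead, ← hj, σ.symm_apply_apply] at this
  · have := congrFun (h2 a) l
    rwa [rowTail, rowTail, ← hj, σ.symm_apply_apply] at this

/-- A code that is a graph is free on its first `t + 1` coordinates. -/
theorem graphCode_mem_codes (B : Matrix (Fin (t - 1)) (Fin (t + 1)) (ZMod p)) :
    graphCode σ B ∈ codes p t (t + 1) := by
  let f : graphCode σ B →ₗ[Mat p] (Fin (t + 1) → Fin 2 → ZMod p) :=
    { toFun := fun X k a => rowHead σ X.1 a k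
      map_add' := fun X Y => rfl
      map_smul' := fun M X => by
        ext k a
        simp only [Submodule.coe_smul, rowHead, row_smul, RingHom.id_apply, Pi.smul_apply]
        rfl }
  refine ⟨LinearEquiv.ofBijective f ⟨fun X Y h => ?_, fun v => ?_⟩⟩
  · have h1 : ∀ a, rowHead σ X.1 a = rowHead σ Y.1 a := fun a =>
      funext fun k => congrFun (congrFun h k) a
    exact Subtype.ext (eq_of_rowHead_rowTail σ h1 fun a => by rw [← X.2 a, ← Y.2 a, h1 a])
  · let X : Fin t → Mat p := fun j => Matrix.of fun a b =>
      Sum.elim (fun k => v k a) (B.mulVec fun k => v k a) (σ (j, b))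
    have h1 : ∀ a, rowHead σ X a = fun k => v k a := fun a => by
      ext k; simp [X, rowHead, row]
    have h2 : ∀ a, rowTail σ X a = B.mulVec fun k => v k a := fun a => by
      ext k; simp [X, rowTail, row]
    exact ⟨⟨X, fun a => by rw [h1, h2]⟩, funext fun k => funext fun a => congrFun (h1 a) k⟩

/-- The linear map splitting a row into its head and its tail. -/
def splitRow : (Fin t × Fin 2 → ZMod p) →ₗ[ZMod p]
    (Fin (t + 1) → ZMod p) × (Fin (t - 1) → ZMod p) where
  toFun v := (fun k => v (σ.symm (Sum.inl k)), fun l => v (σ.symm (Sum.inr l)))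
  map_add' _ _ := rfl
  map_smul' _ _ := rfl

theorem splitRow_ker : LinearMap.ker (splitRow (p := p) σ) = ⊥ := by
  rw [LinearMap.ker_eq_bot']
  intro v hv
  funext j
  rcases hj : σ j with k | l
  · have := congrFun (congrArg Prod.fst hv) k
    simpa [splitRow, ← hj] using this
  · have := congrFun (congrArg Prod.snd hv) l
    simpa [splitRow, ← hj] using this

variable [Fact p.Prime]

open Classical in
theorem card_graphCode_of_linearIndependent {X : Fin t → Mat p}
    (hX : LinearIndependent (ZMod p) (row X)) :
    (Finset.univ.filter fun B => X ∈ graphCode σ B).card * p ^ (2 * (t - 1)) ≤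
      Fintype.card (Matrix (Fin (t - 1)) (Fin (t + 1)) (ZMod p)) := by
  have := card_graph_mul_le (rowHead σ X) (rowTail σ X) (hX.map' (splitRow σ) (splitRow_ker σ))
  rw [ZMod.card, Fintype.card_fin] at this
  convert this using 3
  ext B
  simp [mem_graphCode]

open Classical in
theorem card_graphCode_of_ne_zero {X : Fin t → Mat p} (hX : X ≠ 0) :
    (Finset.univ.filter fun B => X ∈ graphCode σ B).card * p ^ (t - 1) ≤
      Fintype.card (Matrix (Fin (t - 1)) (Fin (t + 1)) (ZMod p)) := by
  obtain ⟨a, ha⟩ : ∃ a, row X a ≠ 0 := by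
    by_contra! h
    exact hX (row_injective (funext h))
  have hli : LinearIndependent (ZMod p) fun _ : Fin 1 => row X a :=
    LinearIndependent.of_subsingleton 0 ha
  have := card_graph_mul_le (fun _ => rowHead σ X a) (fun _ => rowTail σ X a)
    (hli.map' (splitRow σ) (splitRow_ker σ))
  rw [ZMod.card, Fintype.card_fin, one_mul] at this
  refine le_trans (Nat.mul_le_mul_right _ (Finset.card_le_card fun B hB => ?_)) this
  simp only [Finset.mem_filter, Finset.mem_univ, true_and] at hB ⊢
  exact fun _ => hB a

open Classical in
/-- Averaging over the family of graphs: some code meets a weighted set of words in the expected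
amount, up to the words whose two rows are dependent. -/
theorem exists_graphCode_sum_le {ι : Type*} (S : Finset ι) (φ : ι → Fin t → Mat p) (f : ι → ℝ)
    (hf : ∀ x ∈ S, 0 ≤ f x) (hφ : ∀ x ∈ S, φ x ≠ 0) :
    ∃ B, ∑ x ∈ S with φ x ∈ graphCode σ B, f x ≤
      (∑ x ∈ S, f x) / p ^ (2 * (t - 1)) +
      (∑ x ∈ S with ¬ LinearIndependent (ZMod p) (row (φ x)), f x) / p ^ (t - 1) := by
  have hp : (0 : ℝ) < p := by exact_mod_cast (Fact.out : p.Prime).pos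
  set T := (∑ x ∈ S, f x) / p ^ (2 * (t - 1)) +
      (∑ x ∈ S with ¬ LinearIndependent (ZMod p) (row (φ x)), f x) / p ^ (t - 1) with hT
  let N : ℝ := Fintype.card (Matrix (Fin (t - 1)) (Fin (t + 1)) (ZMod p))
  have hsum : ∑ B : Matrix (Fin (t - 1)) (Fin (t + 1)) (ZMod p),
      ∑ x ∈ S with φ x ∈ graphCode σ B, f x ≤
      ∑ _B : Matrix (Fin (t - 1)) (Fin (t + 1)) (ZMod p), T := by
    calc ∑ B : Matrix (Fin (t - 1)) (Fin (t + 1)) (ZMod p),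
          ∑ x ∈ S with φ x ∈ graphCode σ B, f x
        = ∑ x ∈ S, (Finset.univ.filter fun B => φ x ∈ graphCode σ B).card * f x := by
          simp_rw [Finset.sum_filter]
          rw [Finset.sum_comm]
          refine Finset.sum_congr rfl fun x _ => ?_
          rw [← Finset.sum_filter, Finset.sum_const, nsmul_eq_mul]
      _ ≤ ∑ x ∈ S, (N / p ^ (2 * (t - 1)) * f x +
            if ¬ LinearIndependent (ZMod p) (row (φ x)) then N / p ^ (t - 1) * f x else 0) := by
          refine Finset.sum_le_sum fun x hx => ?_
          split_ifs with h
          · have h1 := card_graphCode_of_linearIndependent σ (h)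
            have h1' : ((Finset.univ.filter fun B => φ x ∈ graphCode σ B).card : ℝ) ≤
                N / p ^ (2 * (t - 1)) := by
              rw [le_div_iff₀ (by positivity)]
              simpa [N] using (Nat.cast_le (α := ℝ)).2 h1
            rw [add_zero]
            exact mul_le_mul_of_nonneg_right h1' (hf x hx)
          · have h1 := card_graphCode_of_ne_zero σ (hφ x hx)
            have h1' : ((Finset.univ.filter fun B => φ x ∈ graphCode σ B).card : ℝ) ≤
                N / p ^ (t - 1) := by
              rw [le_div_iff₀ (by positivity)]
              simpa [N] using (Nat.cast_le (α := ℝ)).2 h1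
            have := mul_le_mul_of_nonneg_right h1' (hf x hx)
            have h0 : 0 ≤ N / p ^ (2 * (t - 1)) * f x :=
              mul_nonneg (by positivity) (hf x hx)
            linarith
      _ = N * T := by
          rw [Finset.sum_add_distrib, ← Finset.sum_filter, ← Finset.mul_sum, ← Finset.mul_sum, hT]
          ring
      _ = _ := by
          rw [Finset.sum_const, nsmul_eq_mul, Finset.card_univ]
  obtain ⟨B, -, hB⟩ := Finset.exists_le_of_sum_le Finset.univ_nonempty hsum
  exact ⟨B, hB⟩

end Codes

/-! ### Hurwitz vectors with dependent reductions -/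

section Reduction

variable {p t : ℕ} (e : hurwitz ⧸ idealP p ≃+* Mat p)

theorem reduction_sub (x y : Fin t → hurwitz) :
    reduction e (x - y) = reduction e x - reduction e y := by
  funext i
  simp [reduction]

theorem reduction_add (x y : Fin t → hurwitz) :
    reduction e (x + y) = reduction e x + reduction e y := by
  funext i
  simp [reduction]

theorem reduction_zero : reduction e (0 : Fin t → hurwitz) = 0 := by
  funext i
  simp [reduction]

theorem reduction_smul (c : hurwitz) (x : Fin t → hurwitz) :
    reduction e (c • x) = e (Ideal.Quotient.mk (idealP p) c) • reduction e x := by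
  funext i
  simp [reduction]

theorem reduction_natCast_smul (x : Fin t → hurwitz) : reduction e ((p : hurwitz) • x) = 0 := by
  rw [reduction_smul, Ideal.Quotient.eq_zero_iff_mem.2 (mem_idealP.2 ⟨1, by simp⟩), map_zero,
    zero_smul]

theorem le_norm_inclusion_of_reduction_eq_zero {x : Fin t → hurwitz} (hx : x ≠ 0)
    (h : reduction e x = 0) : (p : ℝ) ≤ ‖inclusion x‖ := by
  obtain ⟨i, hi⟩ := Function.ne_iff.1 hx
  have hmem : x i ∈ idealP p := by
    have := congrFun h i
    exact Ideal.Quotient.eq_zero_iff_mem.1 (e.map_eq_zero_iff.1 this)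
  obtain ⟨y, hy⟩ := mem_idealP.1 hmem
  have hy0 : y ≠ 0 := by
    rintro rfl
    exact hi (by rw [hy, mul_zero]; rfl)
  refine le_trans ?_ (norm_apply_le (inclusion x) i)
  rw [inclusion_apply, hy, Subring.coe_mul, norm_mul, Subring.coe_natCast,
    ← Quaternion.coe_natCast, Quaternion.norm_coe, Real.norm_of_nonneg (Nat.cast_nonneg _)]
  exact le_mul_of_one_le_right (Nat.cast_nonneg _) (one_le_norm_hurwitz hy0)

variable [Fact p.Prime]

/-- Hurwitz vectors whose reductions are killed on the left by a fixed nonzero row vector are at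
mutual distance at least `√p`, because their differences have non-invertible coordinates. -/
theorem sqrt_le_norm_sub {c : Fin 2 → ZMod p} (hc : c ≠ 0) {x y : Fin t → hurwitz}
    (hx : ∀ i, Matrix.vecMul c (reduction e x i) = 0)
    (hy : ∀ i, Matrix.vecMul c (reduction e y i) = 0) (hxy : x ≠ y) :
    √p ≤ ‖inclusion x - inclusion y‖ := by
  obtain ⟨i, hi⟩ := Function.ne_iff.1 hxy
  rw [← inclusion_sub]
  refine le_trans ?_ (norm_apply_le (inclusion (x - y)) i)
  rw [inclusion_apply]
  refine Real.sqrt_le_iff.2 ⟨norm_nonneg _, le_norm_sq_of_not_isUnit Fact.out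
    (sub_ne_zero.2 hi) fun hu => hc ?_⟩
  have hu' : IsUnit (reduction e (x - y) i) := hu.map e
  have h0 : Matrix.vecMul c (reduction e (x - y) i) = Matrix.vecMul 0 (reduction e (x - y) i) := by
    rw [reduction_sub, Pi.sub_apply, Matrix.vecMul_sub, hx, hy, sub_zero, Matrix.zero_vecMul]
  exact Matrix.vecMul_injective_of_isUnit hu' h0

open Classical in
/-- The number of Hurwitz vectors in a ball whose reductions have dependent rows. -/
theorem card_not_linearIndependent_le (ht : 0 < t) (S : Finset (Fin t → hurwitz)) {R : ℝ}
    (hR : 0 ≤ R) (hS : ∀ x ∈ S, ‖inclusion x‖ ≤ R) :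
    ((S.filter fun x => ¬ LinearIndependent (ZMod p) (row (reduction e x))).card : ℝ) ≤
      p ^ 2 * (2 * R / √p + 1) ^ (4 * t) := by
  have hp : (0 : ℝ) < p := by exact_mod_cast (Fact.out : p.Prime).pos
  let T : (Fin 2 → ZMod p) → Finset (Fin t → hurwitz) := fun c =>
    if c = 0 then ∅ else S.filter fun x => ∀ i, Matrix.vecMul c (reduction e x i) = 0
  have hsub : (S.filter fun x => ¬ LinearIndependent (ZMod p) (row (reduction e x))) ⊆
      Finset.univ.biUnion T := by
    intro x hx
    obtain ⟨hxS, hx⟩ := Finset.mem_filter.1 hx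
    obtain ⟨c, hc, a, ha⟩ := Fintype.not_linearIndependent_iff.1 hx
    have hc0 : c ≠ 0 := fun h => ha (by rw [h]; rfl)
    refine Finset.mem_biUnion.2 ⟨c, Finset.mem_univ _, ?_⟩
    simp only [T, if_neg hc0, Finset.mem_filter]
    refine ⟨hxS, fun i => funext fun b => ?_⟩
    have := congrFun hc (i, b)
    simpa [Matrix.vecMul, dotProduct, row] using this
  have hT : ∀ c, ((T c).card : ℝ) ≤ (2 * R / √p + 1) ^ (4 * t) := by
    intro c
    by_cases hc : c = 0
    · simp only [T, if_pos hc, Finset.card_empty, Nat.cast_zero]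
      positivity
    · simp only [T, if_neg hc]
      rw [← Finset.card_map ⟨inclusion, inclusion_injective⟩]
      refine card_le_of_separated ht _ hR (Real.sqrt_pos.2 hp) ?_ ?_
      · intro v hv
        obtain ⟨x, hx, rfl⟩ := Finset.mem_map.1 hv
        exact hS x (Finset.mem_filter.1 hx).1
      · intro v hv w hw hvw
        obtain ⟨x, hx, rfl⟩ := Finset.mem_map.1 hv
        obtain ⟨y, hy, rfl⟩ := Finset.mem_map.1 hw
        exact sqrt_le_norm_sub e hc (Finset.mem_filter.1 hx).2 (Finset.mem_filter.1 hy).2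
          fun h => hvw (by rw [h])
  calc ((S.filter fun x => ¬ LinearIndependent (ZMod p) (row (reduction e x))).card : ℝ)
      ≤ ∑ c, ((T c).card : ℝ) := by
        exact_mod_cast (Finset.card_le_card hsub).trans Finset.card_biUnion_le
    _ ≤ ∑ _c : Fin 2 → ZMod p, (2 * R / √p + 1) ^ (4 * t) := Finset.sum_le_sum fun c _ => hT c
    _ = p ^ 2 * (2 * R / √p + 1) ^ (4 * t) := by
        rw [Finset.sum_const, nsmul_eq_mul, Finset.card_univ, Fintype.card_fun, ZMod.card,
          Fintype.card_fin, Nat.cast_pow]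

end Reduction

/-! ### The lattice attached to a code -/

section Lift

variable {p t : ℕ} (e : hurwitz ⧸ idealP p ≃+* Mat p) (C : Submodule (Mat p) (Fin t → Mat p))

/-- The inverse image of a code under reduction. -/
def lift : Submodule hurwitz (Fin t → hurwitz) where
  carrier := reduction e ⁻¹' C
  add_mem' {x y} hx hy := by
    rw [Set.mem_preimage, reduction_add]
    exact C.add_mem hx hy
  zero_mem' := by
    rw [Set.mem_preimage, reduction_zero]
    exact C.zero_mem
  smul_mem' c x hx := by
    rw [Set.mem_preimage, reduction_smul]
    exact C.smul_mem _ hx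

theorem mem_lift {x : Fin t → hurwitz} : x ∈ lift e C ↔ reduction e x ∈ C := Iff.rfl

theorem natCast_smul_mem_lift (x : Fin t → hurwitz) : (p : hurwitz) • x ∈ lift e C := by
  rw [mem_lift, reduction_natCast_smul]
  exact C.zero_mem

/-- The inclusion of the Hurwitz vectors into `ℍ^t`, followed by scaling by `β`, as a map of left
modules over the Hurwitz integers. -/
def scaledInclusion (t : ℕ) (β : ℝ) : (Fin t → hurwitz) →ₗ[hurwitz] HSpace t where
  toFun x := β • inclusion x
  map_add' x y := by
    rw [← smul_add]
    rfl
  map_smul' c x := by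
    ext i : 1
    change β • ((c : ℍ[ℝ]) * (x i : ℍ[ℝ])) = (c : ℍ[ℝ]) * (β • (x i : ℍ[ℝ]))
    rw [mul_smul_comm]

theorem scaledInclusion_apply {t : ℕ} (β : ℝ) (x : Fin t → hurwitz) :
    scaledInclusion t β x = β • inclusion x := rfl

theorem scaledInclusion_injective {t : ℕ} {β : ℝ} (hβ : 0 < β) :
    Function.Injective (scaledInclusion t β) := fun _ _ h =>
  inclusion_injective (smul_right_injective _ hβ.ne' h)

/-- The scaled inverse image of a code, a submodule of `ℍ^t`. -/
def scaledLift (β : ℝ) : Submodule hurwitz (HSpace t) := (lift e C).map (scaledInclusion t β)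

theorem discreteTopology_scaledLift {β : ℝ} (hβ : 0 < β) :
    DiscreteTopology (scaledLift e C β) := by
  refine DiscreteTopology.of_forall_le_norm (E := (scaledLift e C β).toAddSubgroup) hβ ?_
  rintro ⟨v, x, hx, rfl⟩ hv
  have hx0 : x ≠ 0 := by
    rintro rfl
    exact hv (Subtype.ext (map_zero _))
  change β ≤ ‖scaledInclusion t β x‖
  rw [scaledInclusion_apply, norm_smul, Real.norm_of_nonneg hβ.le]
  exact le_mul_of_one_le_right hβ.le (one_le_norm_inclusion hx0)

theorem span_scaledLift {β : ℝ} (hβ : 0 < β) (hp : 0 < p) :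
    Submodule.span ℝ (scaledLift e C β : Set (HSpace t)) = ⊤ := by
  have hp' : (0 : ℝ) < p := by exact_mod_cast hp
  refine eq_top_of_bounded_distance _ (β * p * √t) fun v => ?_
  obtain ⟨x, hx⟩ := exists_inclusion_norm_sub_le ((β * p)⁻¹ • v)
  refine ⟨scaledInclusion t β ((p : hurwitz) • x),
    Submodule.subset_span ⟨_, natCast_smul_mem_lift e C x, rfl⟩, ?_⟩
  have he : scaledInclusion t β ((p : hurwitz) • x) = (β * p) • inclusion x := by
    rw [scaledInclusion_apply, mul_smul]
    congr 1
    ext i : 1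
    change (((p : hurwitz) : ℍ[ℝ])) * (x i : ℍ[ℝ]) = (p : ℝ) • (x i : ℍ[ℝ])
    rw [Subring.coe_natCast, ← Quaternion.coe_natCast, Quaternion.coe_mul_eq_smul]
  have hv : v - (β * p) • inclusion x = (β * p) • ((β * p)⁻¹ • v - inclusion x) := by
    rw [smul_sub, smul_inv_smul₀ (by positivity)]
  rw [he, hv, norm_smul, Real.norm_of_nonneg (by positivity)]
  exact mul_le_mul_of_nonneg_left hx (by positivity)

theorem nonempty_basis_scaledLift {β : ℝ} (hβ : 0 < β) (hp : 0 < p) :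
    Nonempty (Module.Basis (Fin t) hurwitz (scaledLift e C β)) := by
  have hp0 : (p : hurwitz) ≠ 0 := by
    intro h
    have := congrArg (Subtype.val) h
    rw [Subring.coe_natCast] at this
    have h' : (p : ℍ[ℝ]) = 0 := this
    rw [← Quaternion.coe_natCast] at h'
    have h'' := congrArg QuaternionAlgebra.re h'
    simp at h''
    lia
  obtain ⟨b⟩ := nonempty_basis_of_smul_single_mem (lift e C) hp0 fun i => by
    have := natCast_smul_mem_lift e C (Pi.single i 1)
    rwa [← Pi.single_smul, smul_eq_mul, mul_one] at this
  exact ⟨b.map (Submodule.equivMapOfInjective _ (scaledInclusion_injective hβ) _)⟩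

end Lift

/-! ### Successive minima -/

/-- Greedy choice: a submodule with minimal norms that spans `ℍ^t` contains independent vectors
bounded by the successive minima. -/
theorem exists_linearIndependent_norm_le_quatMin {t : ℕ} (Λ : Submodule hurwitz (HSpace t))
    (hmin : ∀ P : HSpace t → Prop, (∃ v ∈ Λ, P v) → ∃ v ∈ Λ, P v ∧ ∀ w ∈ Λ, P w → ‖v‖ ≤ ‖w‖)
    (hspan : Submodule.span ℝ (Λ : Set (HSpace t)) = ⊤) :
    ∃ x : Fin t → HSpace t, LinearIndependent ℍ[ℝ] x ∧
      ∀ j, x j ∈ Λ ∧ ‖x j‖ ≤ quatMin Λ (j + 1) := by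
  have hspanH : Submodule.span ℍ[ℝ] (Λ : Set (HSpace t)) = ⊤ := by
    refine Submodule.eq_top_iff'.2 fun v => ?_
    have hv : v ∈ Submodule.span ℝ (Λ : Set (HSpace t)) := hspan ▸ Submodule.mem_top
    exact Submodule.span_le_restrictScalars ℝ ℍ[ℝ] _ hv
  have hfin : Module.finrank ℍ[ℝ] (HSpace t) = t := by
    rw [(WithLp.linearEquiv 2 ℍ[ℝ] (Fin t → ℍ[ℝ])).finrank_eq, Module.finrank_fin_fun]
  have key : ∀ k ≤ t, ∃ x : Fin k → HSpace t, LinearIndependent ℍ[ℝ] x ∧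
      ∀ j, x j ∈ Λ ∧ ‖x j‖ ≤ quatMin Λ (j + 1) := by
    intro k
    induction k with
    | zero => exact fun _ => ⟨Fin.elim0, linearIndependent_empty_type, fun j => j.elim0⟩
    | succ k ih =>
      intro hk
      obtain ⟨x, hx, hxΛ⟩ := ih (by lia)
      set W := Submodule.span ℍ[ℝ] (Set.range x) with hW
      have hWrank : Module.finrank ℍ[ℝ] W = k := by
        rw [hW, finrank_span_eq_card hx, Fintype.card_fin]
      have hne : ∃ v ∈ Λ, v ∉ W := by
        by_contra! h
        have : W = ⊤ := top_le_iff.1 (hspanH ▸ Submodule.span_le.2 h)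
        rw [this, finrank_top, hfin] at hWrank
        lia
      obtain ⟨y, hyΛ, hyW, hymin⟩ := hmin (fun v => v ∉ W) hne
      have hxy : LinearIndependent ℍ[ℝ] (Fin.snoc x y : Fin (k + 1) → HSpace t) :=
        linearIndependent_finSnoc.2 ⟨hx, hyW⟩
      refine ⟨Fin.snoc x y, hxy, fun j => ?_⟩
      refine Fin.lastCases ?_ (fun j => ?_) j
      · rw [Fin.snoc_last]
        refine ⟨hyΛ, ?_⟩
        rw [Fin.val_last]
        refine le_csInf ?_ ?_
        · obtain ⟨R, hR⟩ : ∃ R, ∀ i, ‖(Fin.snoc x y : Fin (k + 1) → HSpace t) i‖ ≤ R :=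
            ⟨∑ i, ‖(Fin.snoc x y : Fin (k + 1) → HSpace t) i‖, fun i =>
              Finset.single_le_sum (f := fun i => ‖(Fin.snoc x y : Fin (k + 1) → HSpace t) i‖)
                (fun _ _ => norm_nonneg _) (Finset.mem_univ i)⟩
          refine ⟨R, Fin.snoc x y, fun i => ⟨?_, mem_closedBall_zero_iff.2 (hR i)⟩, hxy⟩
          refine Fin.lastCases ?_ (fun i => ?_) i
          · rwa [Fin.snoc_last]
          · rw [Fin.snoc_castSucc]
            exact (hxΛ i).1
        · rintro r ⟨v, hv, hvli⟩
          obtain ⟨i, hi⟩ : ∃ i, v i ∉ W := by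
            by_contra! h
            have hle : Submodule.span ℍ[ℝ] (Set.range v) ≤ W :=
              Submodule.span_le.2 (Set.range_subset_iff.2 h)
            have := Submodule.finrank_mono hle
            rw [finrank_span_eq_card hvli, hWrank, Fintype.card_fin] at this
            lia
          exact (hymin (v i) (hv i).1 hi).trans (mem_closedBall_zero_iff.1 (hv i).2)
      · rw [Fin.snoc_castSucc]
        exact hxΛ j
  exact key t le_rfl

/-- Norms of Hurwitz vectors are square roots of natural numbers, so minimal ones exist. -/
theorem exists_minimal_norm_scaledLift {p t : ℕ} (e : hurwitz ⧸ idealP p ≃+* Mat p)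
    (C : Submodule (Mat p) (Fin t → Mat p)) (β : ℝ) (P : HSpace t → Prop)
    (h : ∃ v ∈ scaledLift e C β, P v) :
    ∃ v ∈ scaledLift e C β, P v ∧ ∀ w ∈ scaledLift e C β, P w → ‖v‖ ≤ ‖w‖ := by
  let N : (Fin t → hurwitz) → ℕ := fun x => ∑ i, sqNorm (x i)
  have hN : ∀ x, ‖inclusion x‖ ^ 2 = N x := fun x => by
    rw [norm_sq_hspace, Nat.cast_sum]
    exact Finset.sum_congr rfl fun i _ => norm_sq_eq_sqNorm (x i)
  obtain ⟨_, ⟨x₀, hx₀, rfl⟩, hP₀⟩ := h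
  obtain ⟨x, ⟨hx, hxP⟩, hmin⟩ := WellFounded.has_min (measure N).wf
    {x | x ∈ lift e C ∧ P (scaledInclusion t β x)} ⟨x₀, hx₀, hP₀⟩
  refine ⟨_, ⟨x, hx, rfl⟩, hxP, ?_⟩
  rintro _ ⟨y, hy, rfl⟩ hyP
  have hle : N x ≤ N y := not_lt.1 (hmin y ⟨hy, hyP⟩)
  rw [scaledInclusion_apply, scaledInclusion_apply, norm_smul, norm_smul]
  refine mul_le_mul_of_nonneg_left ?_ (norm_nonneg _)
  rw [← abs_of_nonneg (norm_nonneg (inclusion x)), ← abs_of_nonneg (norm_nonneg (inclusion y)),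
    ← sq_le_sq, hN, hN]
  exact_mod_cast hle

/-! ### A weight that detects small products of norms -/

/-- Rogers' truncated logarithmic weight of a vector of norm `u > 0`. It exceeds `s ∈ [0, 1)`
exactly for `u < r exp ((1 / t - s) / 4)`; the value at `u = 0` is irrelevant. -/
def weight (t : ℕ) (r u : ℝ) : ℝ := max 0 (min 1 (1 / t - 4 * Real.log (u / r)))

theorem weight_nonneg (t : ℕ) (r u : ℝ) : 0 ≤ weight t r u := le_max_left _ _

theorem weight_le_one (t : ℕ) (r u : ℝ) : weight t r u ≤ 1 :=
  max_le zero_le_one (min_le_left _ _)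

theorem lt_of_lt_weight {t : ℕ} {r u s : ℝ} (hr : 0 < r) (hu : 0 < u) (hs : 0 ≤ s)
    (h : s < weight t r u) : u < r * Real.exp ((1 / t - s) / 4) := by
  rcases lt_max_iff.1 h with h | h
  · exact absurd h (not_lt.2 hs)
  · have h' := (lt_min_iff.1 h).2
    have hl : Real.log (u / r) < (1 / t - s) / 4 := by linarith
    rwa [Real.log_lt_iff_lt_exp (by positivity), div_lt_iff₀' hr] at hl

/-- If the geometric mean of `t` norms is at most `r`, their weights add up to at least `1`. -/
theorem one_le_sum_weight {t : ℕ} (ht : 0 < t) {r : ℝ} (hr : 0 < r) {u : Fin t → ℝ}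
    (hu : ∀ j, 0 < u j) (h : ∏ j, u j ≤ r ^ t) : 1 ≤ ∑ j, weight t r (u j) := by
  by_cases h1 : ∃ j, 1 ≤ 1 / (t : ℝ) - 4 * Real.log (u j / r)
  · obtain ⟨j, hj⟩ := h1
    have : weight t r (u j) = 1 := by
      rw [weight, min_eq_left hj, max_eq_right zero_le_one]
    rw [← this]
    exact Finset.single_le_sum (f := fun j => weight t r (u j))
      (fun _ _ => weight_nonneg _ _ _) (Finset.mem_univ j)
  · push Not at h1
    have hle : ∀ j, 1 / (t : ℝ) - 4 * Real.log (u j / r) ≤ weight t r (u j) := fun j => by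
      rw [weight, min_eq_right (h1 j).le]
      exact le_max_right _ _
    have ht' : (t : ℝ) ≠ 0 := by exact_mod_cast ht.ne'
    have hlog : ∑ j, Real.log (u j / r) ≤ 0 := by
      rw [← Real.log_prod (fun j _ => (div_pos (hu j) hr).ne')]
      refine Real.log_nonpos (Finset.prod_nonneg fun j _ => (div_pos (hu j) hr).le) ?_
      rw [Finset.prod_div_distrib, Finset.prod_const, Finset.card_univ, Fintype.card_fin,
        div_le_one (by positivity)]
      exact h
    calc (1 : ℝ) ≤ 1 - 4 * ∑ j, Real.log (u j / r) := by linarith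
      _ = ∑ j, (1 / (t : ℝ) - 4 * Real.log (u j / r)) := by
          rw [Finset.sum_sub_distrib, ← Finset.mul_sum, Finset.sum_const, Finset.card_univ,
            Fintype.card_fin, nsmul_eq_mul, mul_one_div_cancel ht']
      _ ≤ _ := Finset.sum_le_sum fun j _ => hle j

theorem integral_ite_lt {a : ℝ} (h0 : 0 ≤ a) (h1 : a ≤ 1) :
    IntervalIntegrable (fun s : ℝ => if s < a then (1 : ℝ) else 0) volume 0 1 ∧
    ∫ s in (0 : ℝ)..1, (if s < a then (1 : ℝ) else 0) = a := by
  have hi : (fun s : ℝ => if s < a then (1 : ℝ) else 0) = (Set.Iio a).indicator 1 := by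
    ext s
    simp [Set.indicator_apply]
  rw [hi]
  constructor
  · rw [intervalIntegrable_iff]
    exact (integrableOn_const (C := (1 : ℝ)) (by simp)).indicator measurableSet_Iio
  · rw [intervalIntegral.integral_of_le zero_le_one, integral_indicator_one measurableSet_Iio,
      measureReal_restrict_apply measurableSet_Iio, measureReal_def]
    have hset : Set.Iio a ∩ Set.Ioc 0 1 = Set.Ioo 0 a := by
      ext s
      simp only [Set.mem_inter_iff, Set.mem_Iio, Set.mem_Ioc, Set.mem_Ioo]
      exact ⟨fun h => ⟨h.2.1, h.1⟩, fun h => ⟨h.2, h.1, h.2.le.trans h1⟩⟩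
    rw [hset, Real.volume_Ioo, sub_zero, ENNReal.toReal_ofReal h0]

/-- Layer cake formula: a sum of numbers in `[0, 1]` is the integral of the sizes of its
superlevel sets. -/
theorem sum_le_of_card_filter_le {ι : Type*} (S : Finset ι) (f : ι → ℝ) (h0 : ∀ x ∈ S, 0 ≤ f x)
    (h1 : ∀ x ∈ S, f x ≤ 1) {t : ℕ} (ht : 0 < t) (K : ℝ)
    (hK : ∀ s : ℝ, 0 ≤ s → s ≤ 1 → ((S.filter fun x => s < f x).card : ℝ) ≤
      K * Real.exp (1 - s * t)) :
    ∑ x ∈ S, f x ≤ K * (Real.exp 1 * (1 - Real.exp (-t)) / t) := by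
  have ht' : (t : ℝ) ≠ 0 := by exact_mod_cast ht.ne'
  have hint : ∫ s in (0 : ℝ)..1, K * Real.exp (1 - s * t) =
      K * (Real.exp 1 * (1 - Real.exp (-t)) / t) := by
    rw [intervalIntegral.integral_const_mul]
    congr 1
    have hd : ∀ s ∈ Set.uIcc (0 : ℝ) 1, HasDerivAt (fun s : ℝ => -Real.exp (1 - s * t) / t)
        (Real.exp (1 - s * t)) s := fun s _ => by
      have h := (((hasDerivAt_id s).mul_const (t : ℝ)).const_sub 1).exp.neg.div_const (t : ℝ)
      refine HasDerivAt.congr_deriv h ?_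
      change -(Real.exp (1 - s * t) * -(1 * t)) / t = Real.exp (1 - s * t)
      field_simp
    rw [intervalIntegral.integral_eq_sub_of_hasDerivAt hd (by
      exact (by fun_prop : Continuous fun s : ℝ => Real.exp (1 - s * t)).intervalIntegrable _ _)]
    rw [zero_mul, one_mul, sub_zero, sub_eq_add_neg (1 : ℝ) (t : ℝ), Real.exp_add]
    ring
  calc ∑ x ∈ S, f x = ∑ x ∈ S, ∫ s in (0 : ℝ)..1, (if s < f x then (1 : ℝ) else 0) :=
        Finset.sum_congr rfl fun x hx => (integral_ite_lt (h0 x hx) (h1 x hx)).2.symm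
    _ = ∫ s in (0 : ℝ)..1, ∑ x ∈ S, (if s < f x then (1 : ℝ) else 0) :=
        (intervalIntegral.integral_finsetSum fun x hx =>
          (integral_ite_lt (h0 x hx) (h1 x hx)).1).symm
    _ ≤ ∫ s in (0 : ℝ)..1, K * Real.exp (1 - s * t) := by
        refine intervalIntegral.integral_mono_on zero_le_one ?_ ?_ fun s hs => ?_
        · have h := IntervalIntegrable.sum (μ := volume) (a := 0) (b := 1) S
            (f := fun x s => if s < f x then (1 : ℝ) else 0)
            (fun x hx => (integral_ite_lt (h0 x hx) (h1 x hx)).1)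
          exact h.congr fun s _ => by simp
        · exact (by fun_prop : Continuous fun s : ℝ =>
            K * Real.exp (1 - s * t)).intervalIntegrable _ _
        · rw [← Finset.sum_filter, Finset.sum_const, nsmul_eq_mul, mul_one]
          exact hK s hs.1 hs.2
    _ = _ := hint

/-- The total weight of the scaled nonzero Hurwitz vectors, compared with the integral of the
weight. -/
theorem sum_weight_le {t : ℕ} (ht : 0 < t) {r β : ℝ} (hr : 0 < r) (hβ : 0 < β)
    (S : Finset (Fin t → hurwitz)) (hS : ∀ x ∈ S, x ≠ 0) :
    ∑ x ∈ S, weight t r (β * ‖inclusion x‖) ≤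
      (r / β) ^ (4 * t) * unitBallVolume t / hurwitzCovolume t *
        Real.exp (8 * t * (β * √t / r)) * (Real.exp 1 * (1 - Real.exp (-t)) / t) := by
  have hV := hurwitzCovolume_pos t
  have ht' : (t : ℝ) ≠ 0 := by exact_mod_cast ht.ne'
  refine sum_le_of_card_filter_le S _ (fun _ _ => weight_nonneg _ _ _)
    (fun _ _ => weight_le_one _ _ _) ht _ fun s hs0 hs1 => ?_
  set ρ : ℝ := Real.exp ((1 / t - s) / 4) with hρ
  have hρpos : 0 < ρ := Real.exp_pos _
  have hcard := card_hurwitz_le ht (S.filter fun x => s < weight t r (β * ‖inclusion x‖))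
    (R := r / β * ρ) (by positivity) (fun x hx => by
      obtain ⟨hxS, hx⟩ := Finset.mem_filter.1 hx
      have hpos : 0 < ‖inclusion x‖ :=
        lt_of_lt_of_le one_pos (one_le_norm_inclusion (hS x hxS))
      have := lt_of_lt_weight hr (mul_pos hβ hpos) hs0 hx
      rw [div_mul_eq_mul_div, le_div_iff₀ hβ, mul_comm]
      exact this.le)
  rw [← le_div_iff₀ hV] at hcard
  refine hcard.trans ?_
  -- the radius exceeds `r / (2 β)`, so adding `√t` changes it by a controlled factor
  have hρ2 : 1 / 2 ≤ ρ := by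
    have h1 : (-1 / 4 : ℝ) ≤ (1 / t - s) / 4 := by
      have : (0 : ℝ) ≤ 1 / t := by positivity
      linarith
    have h2 := Real.add_one_le_exp (-1 / 4 : ℝ)
    have h3 := Real.exp_le_exp.2 h1
    linarith
  have hbase : r / β * ρ + √t ≤ r / β * ρ * Real.exp (2 * (β * √t / r)) := by
    have h1 := Real.add_one_le_exp (2 * (β * √t / r))
    have h2 : r / β * ρ * (2 * (β * √t / r) + 1) = 2 * ρ * √t + r / β * ρ := by
      field_simp
    have h3 := mul_le_mul_of_nonneg_left h1 (by positivity : 0 ≤ r / β * ρ)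
    have h4 : 1 * √t ≤ 2 * ρ * √t :=
      mul_le_mul_of_nonneg_right (by linarith) (Real.sqrt_nonneg _)
    linarith
  have hpow := pow_le_pow_left₀ (by positivity) hbase (4 * t)
  have hρt : ρ ^ (4 * t) = Real.exp (1 - s * t) := by
    rw [hρ, ← Real.exp_nat_mul]
    congr 1
    push_cast
    field_simp
  have het : Real.exp (2 * (β * √t / r)) ^ (4 * t) = Real.exp (8 * t * (β * √t / r)) := by
    rw [← Real.exp_nat_mul]
    congr 1
    push_cast
    ring
  rw [mul_pow, mul_pow (r / β), hρt, het] at hpow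
  have hκ := unitBallVolume_pos t
  calc (r / β * ρ + √t) ^ (4 * t) * unitBallVolume t / hurwitzCovolume t
      ≤ ((r / β) ^ (4 * t) * Real.exp (1 - s * t) * Real.exp (8 * t * (β * √t / r))) *
          unitBallVolume t / hurwitzCovolume t := by gcongr
    _ = _ := by ring

/-! ### A lattice with large minima -/

theorem finite_norm_inclusion_le (t : ℕ) (R : ℝ) :
    {x : Fin t → hurwitz | ‖inclusion x‖ ≤ R}.Finite := by
  have hfin :
      (Metric.closedBall (0 : HSpace t) R ∩ (hurwitzLattice t : Set (HSpace t))).Finite := by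
    have : DiscreteTopology (hurwitzLattice t).toAddSubgroup :=
      inferInstanceAs (DiscreteTopology (hurwitzLattice t))
    exact Metric.finite_isBounded_inter_isClosed DiscreteTopology.isDiscrete
      Metric.isBounded_closedBall
      (AddSubgroup.isClosed_of_discrete (H := (hurwitzLattice t).toAddSubgroup))
  refine Set.Finite.of_finite_image (hfin.subset ?_) inclusion_injective.injOn
  rintro _ ⟨x, hx, rfl⟩
  exact ⟨mem_closedBall_zero_iff.2 hx, mem_hurwitzLattice.2 ⟨x, rfl⟩⟩

open Classical in
/-- If the nonzero vectors of a scaled lift have total weight less than `24`, the geometric mean of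
its minima exceeds `r`: otherwise `t` independent vectors realizing small minima, multiplied by the
`24` units, would have total weight at least `24`. -/
theorem lt_prod_quatMin {p t : ℕ} (ht : 0 < t) (hp : 0 < p) {r β R : ℝ} (hr : 0 < r) (hβ : 0 < β)
    (hR : r * Real.exp (1 / t / 4) ≤ β * R)
    (e : hurwitz ⧸ idealP p ≃+* Mat p) (C : Submodule (Mat p) (Fin t → Mat p))
    (S : Finset (Fin t → hurwitz)) (hS : ∀ x, x ∈ S ↔ ‖inclusion x‖ ≤ R ∧ x ≠ 0)
    (hsum : ∑ x ∈ S with reduction e x ∈ C, weight t r (β * ‖inclusion x‖) < 24) :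
    r < (∏ j ∈ Finset.Icc 1 t, quatMin (scaledLift e C β) j) ^ (1 / (t : ℝ)) := by
  by_contra! hle
  obtain ⟨x, hxli, hx⟩ := exists_linearIndependent_norm_le_quatMin (scaledLift e C β)
    (exists_minimal_norm_scaledLift e C β) (span_scaledLift e C hβ hp)
  choose y hyC hyx using fun j => (hx j).1
  have hyx : ∀ j, β • inclusion (y j) = x j := hyx
  have hnorm : ∀ j, ‖x j‖ = β * ‖inclusion (y j)‖ := fun j => by
    rw [← hyx j, norm_smul, Real.norm_of_nonneg hβ.le]
  have hx0 : ∀ j, 0 < ‖x j‖ := fun j => norm_pos_iff.2 (hxli.ne_zero j)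
  have hprod : ∏ j, ‖x j‖ ≤ r ^ t := by
    have h1 : ∏ j, ‖x j‖ ≤ ∏ j ∈ Finset.Icc 1 t, quatMin (scaledLift e C β) j := by
      rw [← Finset.Ico_add_one_right_eq_Icc, Finset.prod_Ico_eq_prod_range,
        Finset.prod_range]
      refine Finset.prod_le_prod (fun j _ => norm_nonneg _) fun j _ => ?_
      rw [add_comm 1]
      exact (hx j).2
    have h2 : 0 ≤ ∏ j ∈ Finset.Icc 1 t, quatMin (scaledLift e C β) j :=
      (Finset.prod_nonneg fun j _ => norm_nonneg _).trans h1
    refine h1.trans ?_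
    have h3 := pow_le_pow_left₀ (Real.rpow_nonneg h2 _) hle t
    rwa [one_div, Real.rpow_inv_natCast_pow h2 ht.ne'] at h3
  have hw := one_le_sum_weight ht hr hx0 hprod
  obtain ⟨U, hU, hU1⟩ := exists_finset_norm_eq_one
  have huy : ∀ (u : hurwitz) (j : Fin t),
      β • inclusion (u • y j) = (u : ℍ[ℝ]) • x j := fun u j => by
    rw [← hyx j]
    exact (scaledInclusion t β).map_smul u (y j)
  let F : Fin t × hurwitz → (Fin t → hurwitz) := fun a => a.2 • y a.1
  have hunit0 : ∀ u ∈ U, (u : ℍ[ℝ]) ≠ 0 := fun u hu h => by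
    have := hU1 u hu
    rw [h, norm_zero] at this
    exact zero_ne_one this
  have hF : Set.InjOn F (Finset.univ ×ˢ U : Finset (Fin t × hurwitz)) := by
    rintro ⟨j, u⟩ hju ⟨k, v⟩ hkv h
    have hu : u ∈ U := (Finset.mem_product.1 hju).2
    have h' : (u : ℍ[ℝ]) • x j = (v : ℍ[ℝ]) • x k := by
      rw [← huy, ← huy]
      exact congrArg (fun z => β • inclusion z) h
    have hjk : j = k := by
      by_contra hjk
      refine hxli.notMem_span_image (s := {k}) (x := j) hjk ?_
      rw [Set.image_singleton]
      refine Submodule.mem_span_singleton.2 ⟨(u : ℍ[ℝ])⁻¹ * v, ?_⟩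
      rw [mul_smul, ← h', inv_smul_smul₀ (hunit0 u hu)]
    subst hjk
    have huv : (u : ℍ[ℝ]) = v := smul_left_injective _ (hxli.ne_zero j) h'
    rw [Subtype.ext huv]
  have hFw : ∀ a ∈ (Finset.univ ×ˢ U : Finset (Fin t × hurwitz)),
      β * ‖inclusion (F a)‖ = ‖x a.1‖ := fun a ha => by
    have h1 : ‖β • inclusion (F a)‖ = ‖(a.2 : ℍ[ℝ]) • x a.1‖ := by rw [← huy]
    rwa [norm_smul, norm_smul, Real.norm_of_nonneg hβ.le, hU1 a.2 (Finset.mem_product.1 ha).2,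
      one_mul] at h1
  have htotal : ∑ z ∈ (Finset.univ ×ˢ U : Finset (Fin t × hurwitz)).image F,
      weight t r (β * ‖inclusion z‖) = 24 * ∑ j, weight t r ‖x j‖ := by
    rw [Finset.sum_image hF, Finset.sum_congr rfl fun a ha => by rw [hFw a ha],
      Finset.sum_product]
    simp only [Finset.sum_const, hU, nsmul_eq_mul, Nat.cast_ofNat]
    rw [Finset.mul_sum]
  have hle24 : ∑ z ∈ (Finset.univ ×ˢ U : Finset (Fin t × hurwitz)).image F,
      weight t r (β * ‖inclusion z‖) ≤
      ∑ z ∈ S with reduction e z ∈ C, weight t r (β * ‖inclusion z‖) := by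
    rw [← Finset.sum_filter_ne_zero]
    refine Finset.sum_le_sum_of_subset_of_nonneg (fun z hz => ?_)
      fun _ _ _ => weight_nonneg _ _ _
    obtain ⟨hz, hz0⟩ := Finset.mem_filter.1 hz
    obtain ⟨a, ha, rfl⟩ := Finset.mem_image.1 hz
    have hpos : 0 < β * ‖inclusion (F a)‖ := by
      rw [hFw a ha]
      exact hx0 _
    refine Finset.mem_filter.2 ⟨(hS _).2 ⟨?_, ?_⟩, (lift e C).smul_mem a.2 (hyC a.1)⟩
    · have h1 := lt_of_lt_weight hr hpos le_rfl
        (lt_of_le_of_ne (weight_nonneg _ _ _) (Ne.symm hz0))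
      rw [sub_zero] at h1
      exact le_of_mul_le_mul_left (h1.le.trans hR) hβ
    · intro h0
      rw [h0, inclusion_zero, norm_zero, mul_zero] at hpos
      exact lt_irrefl _ hpos
  linarith

/-- A lattice with large minima exists once the mean total weight over the family of codes is
less than `24`. The second summand in `hmean` accounts for the vectors whose reductions have
dependent rows. -/
theorem exists_graphCode_lt_prod_quatMin {p t : ℕ} [Fact p.Prime] (ht : 0 < t)
    (e : hurwitz ⧸ idealP p ≃+* Mat p) {r β R : ℝ} (hr : 0 < r) (hβ : 0 < β)
    (hβp : β ^ (4 * t) * (p : ℝ) ^ (2 * (t - 1)) = 1)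
    (hR : r * Real.exp (1 / t / 4) = β * R) (hRp : R < p)
    (hmean : r ^ (4 * t) * unitBallVolume t / hurwitzCovolume t *
        Real.exp (8 * t * (β * √t / r)) * (Real.exp 1 * (1 - Real.exp (-t)) / t) +
        p ^ 2 * (2 * R / √p + 1) ^ (4 * t) / p ^ (t - 1) < 24) :
    ∃ C ∈ codes p t (t + 1),
      r < (∏ j ∈ Finset.Icc 1 t, quatMin (scaledLift e C β) j) ^ (1 / (t : ℝ)) := by
  classical
  have hp : (0 : ℝ) < p := by exact_mod_cast (Fact.out : p.Prime).pos
  have hR0 : 0 ≤ R := by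
    by_contra! h
    have h1 : 0 < r * Real.exp (1 / t / 4) := mul_pos hr (Real.exp_pos _)
    rw [hR] at h1
    exact absurd h1 (not_lt.2 (mul_nonpos_of_nonneg_of_nonpos hβ.le h.le))
  let σ : Fin t × Fin 2 ≃ Fin (t + 1) ⊕ Fin (t - 1) := Fintype.equivOfCardEq (by simp; lia)
  let S : Finset (Fin t → hurwitz) :=
    (finite_norm_inclusion_le t R).toFinset.filter fun x => x ≠ 0
  have hS : ∀ x, x ∈ S ↔ ‖inclusion x‖ ≤ R ∧ x ≠ 0 := fun x => by simp [S]
  obtain ⟨B, hB⟩ := exists_graphCode_sum_le σ S (reduction e)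
    (fun x => weight t r (β * ‖inclusion x‖)) (fun _ _ => weight_nonneg _ _ _) fun x hx h => by
      have := le_norm_inclusion_of_reduction_eq_zero e ((hS x).1 hx).2 h
      exact absurd (this.trans ((hS x).1 hx).1) (not_le.2 hRp)
  refine ⟨graphCode σ B, graphCode_mem_codes σ B, lt_prod_quatMin ht (Fact.out : p.Prime).pos hr hβ
    hR.le e _ S hS (hB.trans_lt (lt_of_le_of_lt (add_le_add ?_ ?_) hmean))⟩
  · have h1 := sum_weight_le ht hr hβ S fun x hx => ((hS x).1 hx).2
    rw [div_le_iff₀ (by positivity)]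
    refine h1.trans (le_of_eq ?_)
    have hβ' : (β ^ (4 * t))⁻¹ = (p : ℝ) ^ (2 * (t - 1)) := inv_eq_of_mul_eq_one_right hβp
    rw [div_pow, div_eq_mul_inv (r ^ (4 * t)), hβ']
    ring
  · refine div_le_div_of_nonneg_right ?_ (by positivity)
    refine le_trans ?_ (card_not_linearIndependent_le e ht S hR0 fun x hx => ((hS x).1 hx).1)
    rw [← nsmul_one, ← Finset.sum_const]
    exact Finset.sum_le_sum fun x _ => weight_le_one _ _ _

theorem scaledLift_mem_rescaledLifts {p t : ℕ} (e : hurwitz ⧸ idealP p ≃+* Mat p)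
    {C : Submodule (Mat p) (Fin t → Mat p)} (hC : C ∈ codes p t (t + 1)) :
    (scaledLift e C ((p : ℝ) ^ ((1 - t : ℝ) / (2 * t))) : Set (HSpace t)) ∈ rescaledLifts e t :=
  ⟨C, hC, rfl⟩

/-! ### Estimates for large rank -/

theorem tendsto_riemannZeta_four_mul :
    Tendsto (fun t : ℕ => (riemannZeta (4 * t)).re) atTop (𝓝 1) := by
  have h := LSeries.tendsto_atTop (f := 1) (by
    rw [LSeries.abscissaOfAbsConv_one]
    exact_mod_cast EReal.coe_lt_top 1)
  have h4 : Tendsto (fun t : ℕ => (4 : ℝ) * t) atTop atTop :=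
    tendsto_natCast_atTop_atTop.const_mul_atTop (by norm_num)
  have h' := (Complex.continuous_re.tendsto _).comp (h.comp h4)
  rw [Pi.one_apply, Complex.one_re] at h'
  refine h'.congr' ?_
  filter_upwards [eventually_ge_atTop 1] with t ht
  have ht' : (1 : ℝ) ≤ t := by exact_mod_cast ht
  have hre : 1 < (((4 : ℝ) * t : ℝ) : ℂ).re := by
    rw [Complex.ofReal_re]
    linarith
  simp only [Function.comp_apply]
  rw [LSeries_one_eq_riemannZeta hre]
  norm_num

theorem hurwitzCovolume_le {t : ℕ} (ht : 0 < t) :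
    hurwitzCovolume t ≤ √t ^ (4 * t) * unitBallVolume t := by
  rw [hurwitzCovolume_eq, ← volumeReal_closedBall ht 0 (Real.sqrt_nonneg _)]
  exact measureReal_mono (fundamentalBoxes_subset t) measure_closedBall_lt_top.ne

/-- A ball of volume at most `16 ^ t` times the covolume has radius at most `2 √t`, because the
ball of radius `√t` contains a fundamental domain. -/
theorem radius_le {t : ℕ} (ht : 0 < t) {r c : ℝ} (hr : 0 < r) (hc : c ≤ 16 ^ t)
    (h : r ^ (4 * t) * unitBallVolume t = c * hurwitzCovolume t) : r ≤ 2 * √t := by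
  have hκ := unitBallVolume_pos t
  have hV := hurwitzCovolume_pos t
  have h1 : r ^ (4 * t) * unitBallVolume t ≤ (2 * √t) ^ (4 * t) * unitBallVolume t := by
    have h16 : (2 : ℝ) ^ (4 * t) = 16 ^ t := by rw [pow_mul]; norm_num
    rw [h, mul_pow, h16, mul_assoc]
    exact mul_le_mul hc (hurwitzCovolume_le ht) hV.le (by positivity)
  exact (pow_le_pow_iff_left₀ hr.le (by positivity) (by lia)).1 (le_of_mul_le_mul_right h1 hκ)

/-- A ball whose volume is at least the covolume has radius of order at least `√t`, by the lower
bound for the covolume and `n ^ n / n! ≤ e ^ n`. -/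
theorem sqrt_le_radius {t : ℕ} (ht : 0 < t) {r c : ℝ} (hr : 0 < r) (hc : 1 ≤ c)
    (h : r ^ (4 * t) * unitBallVolume t = c * hurwitzCovolume t) : √t / 20 ≤ r := by
  have hκ := unitBallVolume_pos t
  have hV := hurwitzCovolume_pos t
  have ht' : (0 : ℝ) < t := by exact_mod_cast ht
  refine (pow_le_pow_iff_left₀ (by positivity) hr.le (by lia : 4 * t ≠ 0)).1
    (le_of_mul_le_mul_right ?_ hκ)
  rw [h]
  have h8 : (8⁻¹ : ℝ) ^ (4 * t) ≤ c * hurwitzCovolume t :=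
    (inv_eight_pow_le_hurwitzCovolume t).trans (le_mul_of_one_le_left hV.le hc)
  refine le_trans ?_ h8
  have hfac := Real.pow_div_factorial_le_exp (2 * t : ℝ) (by positivity) (2 * t)
  have hexp : Real.exp (2 * t : ℝ) = Real.exp 1 ^ (2 * t) := by
    rw [← Real.exp_nat_mul]
    push_cast
    ring_nf
  have hsq : (√t / 20) ^ (4 * t) = (t / 400 : ℝ) ^ (2 * t) := by
    rw [show 4 * t = 2 * (2 * t) by ring, pow_mul, div_pow, Real.sq_sqrt ht'.le]
    norm_num
  have hsq8 : (8⁻¹ : ℝ) ^ (4 * t) = (1 / 64 : ℝ) ^ (2 * t) := by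
    rw [show 4 * t = 2 * (2 * t) by ring, pow_mul]
    norm_num
  rw [hsq, hsq8, unitBallVolume]
  have hpi : Real.pi ≤ 63 / 20 := by
    have := Real.pi_lt_d2
    linarith
  have he : Real.exp 1 ≤ 19 / 7 + 1 / 100 := by
    have := Real.exp_one_lt_d9
    linarith
  calc (t / 400 : ℝ) ^ (2 * t) * (Real.pi ^ (2 * t) / (2 * t).factorial)
      = (Real.pi / 800) ^ (2 * t) * ((2 * t : ℝ) ^ (2 * t) / (2 * t).factorial) := by
        rw [mul_div_assoc', mul_div_assoc', ← mul_pow, ← mul_pow]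
        congr 2
        ring
    _ ≤ (Real.pi / 800) ^ (2 * t) * Real.exp 1 ^ (2 * t) := by
        rw [← hexp]
        have := Real.pi_pos
        gcongr
    _ = (Real.pi / 800 * Real.exp 1) ^ (2 * t) := (mul_pow _ _ _).symm
    _ ≤ (1 / 64 : ℝ) ^ (2 * t) := by
        have := Real.pi_pos
        have := Real.exp_pos 1
        refine pow_le_pow_left₀ (by positivity) ?_ _
        calc Real.pi / 800 * Real.exp 1 ≤ 63 / 20 / 800 * (19 / 7 + 1 / 100) := by gcongr
          _ ≤ 1 / 64 := by norm_num

/-- With `q ^ ((1 - t) / (2 t))` the scaling factor, `t β` is small when `t² / q` is. -/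
theorem mul_rpow_le {t : ℕ} (ht : 2 ≤ t) {q : ℝ} (hq : 0 < q) (hδ : (t : ℝ) ^ 2 / q ≤ 1) :
    t * q ^ ((1 - t : ℝ) / (2 * t)) ≤ Real.exp 1 * ((t : ℝ) ^ 2 / q) ^ (1 / 4 : ℝ) := by
  have ht2 : (2 : ℝ) ≤ t := by exact_mod_cast ht
  have ht0 : (0 : ℝ) < t := by linarith
  set δ := (t : ℝ) ^ 2 / q with hδdef
  have hδ0 : 0 < δ := by positivity
  have hqδ : q = (t : ℝ) ^ (2 : ℝ) / δ := by
    rw [hδdef, Real.rpow_two]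
    field_simp
  have h1 : t * q ^ ((1 - t : ℝ) / (2 * t)) =
      (t : ℝ) ^ (1 / t : ℝ) * δ ^ ((t - 1 : ℝ) / (2 * t)) := by
    rw [hqδ, Real.div_rpow (by positivity) hδ0.le, ← Real.rpow_mul ht0.le, div_eq_mul_inv,
      ← Real.rpow_neg hδ0.le, ← mul_assoc]
    nth_rewrite 1 [← Real.rpow_one (t : ℝ)]
    rw [← Real.rpow_add ht0]
    congr 2
    · field_simp
      ring
    · field_simp
      ring
  rw [h1]
  refine mul_le_mul ?_ ?_ (by positivity) (Real.exp_pos _).le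
  · calc (t : ℝ) ^ (1 / t : ℝ) ≤ Real.exp t ^ (1 / t : ℝ) := by
          refine Real.rpow_le_rpow ht0.le ?_ (by positivity)
          linarith [Real.add_one_le_exp (t : ℝ)]
      _ = Real.exp 1 := by
          rw [← Real.exp_mul, mul_one_div_cancel ht0.ne']
  · refine Real.rpow_le_rpow_of_exponent_ge hδ0 hδ ?_
    rw [div_le_div_iff₀ (by norm_num) (by positivity)]
    linarith

/-- The contribution of the vectors with dependent reductions is negligible if `t² / q` is
small. -/
theorem dependent_error_le {t : ℕ} (ht : 3 ≤ t) {q x : ℝ} (hq : 0 < q) (hx0 : 0 ≤ x)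
    (hx : x ≤ 7 * √t) (hδ : 2401 * ((t : ℝ) ^ 2 / q) ≤ 1 / 2) :
    q ^ 2 * x ^ (4 * t) / q ^ (t - 1) ≤ 2401 ^ 3 * 8 * ((t : ℝ) ^ 6 * (1 / 2) ^ t) := by
  have ht0 : (0 : ℝ) < t := by exact_mod_cast (by lia : 0 < t)
  have hx4 : x ^ (4 * t) ≤ (2401 * (t : ℝ) ^ 2) ^ t := by
    rw [pow_mul]
    refine pow_le_pow_left₀ (by positivity) ?_ _
    calc x ^ 4 ≤ (7 * √t) ^ 4 := pow_le_pow_left₀ hx0 hx 4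
      _ = 2401 * (√(t : ℝ) ^ 2) ^ 2 := by ring
      _ = 2401 * (t : ℝ) ^ 2 := by rw [Real.sq_sqrt ht0.le]
  obtain ⟨k, rfl⟩ : ∃ k, t = k + 3 := ⟨t - 3, by lia⟩
  set τ : ℝ := ((k + 3 : ℕ) : ℝ)
  calc q ^ 2 * x ^ (4 * (k + 3)) / q ^ (k + 3 - 1)
      ≤ q ^ 2 * (2401 * τ ^ 2) ^ (k + 3) / q ^ (k + 3 - 1) := by gcongr
    _ = (2401 * τ ^ 2) ^ 3 * (2401 * (τ ^ 2 / q)) ^ k := by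
        rw [show k + 3 - 1 = k + 2 by lia, pow_add _ k 3, pow_add q k 2,
          mul_div_assoc' 2401, div_pow _ q]
        field_simp
    _ ≤ (2401 * τ ^ 2) ^ 3 * (1 / 2) ^ k := by gcongr
    _ = 2401 ^ 3 * 8 * (τ ^ 6 * (1 / 2) ^ (k + 3)) := by
        rw [pow_add _ k 3]
        ring

end HurwitzCodes

end

open HurwitzCodes
theorem proposition5p5 (ε : ℝ) (hε0 : 0 < ε) (hε1 : ε < 1)
    (p : ℕ → ℕ) (hp : ∀ t, (p t).Prime ∧ Odd (p t))
    (hpt : (fun t : ℕ => (t : ℝ) ^ 2) =o[atTop] (fun t : ℕ => (p t : ℝ))) :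
    ∀ᶠ t : ℕ in atTop,
      ∃ r : ℝ, 0 < r ∧
        volume (Metric.closedBall (0 : HSpace t) r) =
          ENNReal.ofReal ((1 - ε) * (24 * t * hurwitzCovolume t * (riemannZeta (4 * t)).re /
            (Real.exp 1 * (1 - Real.exp (-t))))) ∧
        Nonempty (hurwitz ⧸ idealP (p t) ≃+* Mat (p t)) ∧
        ∀ e : hurwitz ⧸ idealP (p t) ≃+* Mat (p t),
          ∃ Λ : Submodule hurwitz (HSpace t),
            (Λ : Set (HSpace t)) ∈ rescaledLifts e t ∧
            DiscreteTopology Λ ∧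
            Submodule.span ℝ (Λ : Set (HSpace t)) = ⊤ ∧
            Nonempty (Module.Basis (Fin t) hurwitz Λ) ∧
            r < (∏ j ∈ Finset.Icc 1 t, quatMin Λ j) ^ (1 / (t : ℝ)) := by
  have hδ : Tendsto (fun t : ℕ => (t : ℝ) ^ 2 / p t) atTop (𝓝 0) := hpt.tendsto_div_nhds_zero
  have hζ := tendsto_riemannZeta_four_mul
  -- the bound for the mean total weight tends to `24 (1 - ε)`
  have hmean : Tendsto (fun t : ℕ => (1 - ε) * (24 * (riemannZeta (4 * t)).re) *
      Real.exp (160 * (Real.exp 1 * ((t : ℝ) ^ 2 / p t) ^ (1 / 4 : ℝ))) +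
      2401 ^ 3 * 8 * ((t : ℝ) ^ 6 * (1 / 2) ^ t)) atTop (𝓝 ((1 - ε) * 24)) := by
    have h1 : Tendsto (fun t : ℕ => ((t : ℝ) ^ 2 / p t) ^ (1 / 4 : ℝ)) atTop (𝓝 0) := by
      have := hδ.rpow_const (p := 1 / 4) (Or.inr (by norm_num))
      rwa [Real.zero_rpow (by norm_num)] at this
    have h2 := Real.continuous_exp.continuousAt.tendsto.comp
      ((h1.const_mul (Real.exp 1)).const_mul 160)
    have h3 : Tendsto (fun t : ℕ => (t : ℝ) ^ 6 * (1 / 2) ^ t) atTop (𝓝 0) :=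
      tendsto_pow_const_mul_const_pow_of_abs_lt_one 6 (by norm_num [abs_of_pos])
    have h4 := (((hζ.const_mul 24).const_mul (1 - ε)).mul h2).add (h3.const_mul (2401 ^ 3 * 8))
    simpa [Function.comp_def] using h4
  have hlt : (1 - ε) * 24 < 24 := by linarith
  have hexp : Tendsto (fun t : ℕ => Real.exp (-t)) atTop (𝓝 0) :=
    Real.tendsto_exp_neg_atTop_nhds_zero.comp tendsto_natCast_atTop_atTop
  filter_upwards [hmean.eventually_lt_const hlt,
    hζ.eventually_const_lt (by norm_num : 1 / 2 < (1 : ℝ)),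
    hζ.eventually_lt_const (by norm_num : (1 : ℝ) < 2),
    hexp.eventually_lt_const (by norm_num : (0 : ℝ) < 1 / 2),
    hδ.eventually_lt_const (by norm_num : (0 : ℝ) < 1 / 4802), eventually_ge_atTop 3,
    (tendsto_natCast_atTop_atTop (R := ℝ)).eventually_ge_atTop (1 / (1 - ε))]
    with t hmean hζ1 hζ2 hexp hδ ht htε
  have ht0 : 0 < t := by lia
  have htR : (3 : ℝ) ≤ t := by exact_mod_cast ht
  have htR0 : (0 : ℝ) < t := by linarith
  obtain ⟨hprime, hodd⟩ := hp t
  have : Fact (p t).Prime := ⟨hprime⟩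
  have hq : (0 : ℝ) < p t := by exact_mod_cast hprime.pos
  have hV := hurwitzCovolume_pos t
  have hκ := unitBallVolume_pos t
  have he1 := Real.exp_one_gt_d9
  have he2 := Real.exp_one_lt_d9
  have hε' : 0 < 1 - ε := by linarith
  set ζ := (riemannZeta (4 * t)).re
  have hIpos : 0 < Real.exp 1 * (1 - Real.exp (-t)) := mul_pos (by linarith) (by linarith)
  set c : ℝ := (1 - ε) * (24 * t * ζ / (Real.exp 1 * (1 - Real.exp (-t)))) with hc
  have hc1 : 1 ≤ c := by
    have h1 : 1 ≤ (1 - ε) * t := by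
      rwa [div_le_iff₀' hε'] at htε
    have h2 : 1 ≤ 24 * ζ / (Real.exp 1 * (1 - Real.exp (-t))) := by
      rw [one_le_div hIpos]
      nlinarith [Real.exp_pos (-t : ℝ)]
    calc (1 : ℝ) ≤ ((1 - ε) * t) * (24 * ζ / (Real.exp 1 * (1 - Real.exp (-t)))) :=
          one_le_mul_of_one_le_of_one_le h1 h2
      _ = c := by rw [hc]; ring
  have hc16 : c ≤ 16 ^ t := by
    have h1 : 24 * t * ζ / (Real.exp 1 * (1 - Real.exp (-t))) ≤ 48 * t := by
      rw [div_le_iff₀ hIpos]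
      have h2 : 1 ≤ Real.exp 1 * (1 - Real.exp (-t)) := by nlinarith
      nlinarith
    have h2 : c ≤ 48 * t :=
      (mul_le_of_le_one_left (by positivity) (by linarith)).trans h1
    have h3 : (48 : ℝ) * t ≤ 16 ^ t := by
      have : ∀ n : ℕ, 3 ≤ n → 48 * n ≤ 16 ^ n := fun n hn => by
        induction n, hn using Nat.le_induction with
        | base => norm_num
        | succ n hn ih => rw [pow_succ]; lia
      exact_mod_cast this t ht
    exact h2.trans h3
  have hX : 0 < c * hurwitzCovolume t / unitBallVolume t := by positivity
  set r : ℝ := (c * hurwitzCovolume t / unitBallVolume t) ^ (((4 * t : ℕ) : ℝ)⁻¹) with hrdef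
  have hr : 0 < r := Real.rpow_pos_of_pos hX _
  have hrpow : r ^ (4 * t) * unitBallVolume t = c * hurwitzCovolume t := by
    rw [hrdef, Real.rpow_inv_natCast_pow hX.le (by lia), div_mul_cancel₀ _ hκ.ne']
  have hrlow := sqrt_le_radius ht0 hr hc1 hrpow
  have hrup := radius_le ht0 hr hc16 hrpow
  refine ⟨r, hr, ?_, nonempty_quotient_ringEquiv hprime hodd, fun e => ?_⟩
  · rw [volume_closedBall_hspace ht0 0 hr.le, hrpow, hc]
    congr 1
    ring
  -- `β` normalizes the lifts of the codes, of index `p ^ (2 (t - 1))`, to the covolume of `H^t`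
  set β : ℝ := (p t : ℝ) ^ ((1 - t : ℝ) / (2 * t)) with hβdef
  have hβ : 0 < β := Real.rpow_pos_of_pos hq _
  have hβp : β ^ (4 * t) * (p t : ℝ) ^ (2 * (t - 1)) = 1 := by
    rw [← Real.rpow_natCast β, ← Real.rpow_natCast (p t : ℝ), hβdef, ← Real.rpow_mul hq.le,
      ← Real.rpow_add hq]
    push_cast [Nat.cast_sub (by lia : 1 ≤ t)]
    rw [show (1 - t : ℝ) / (2 * t) * (4 * t) + 2 * (t - 1) = 0 by field_simp; ring,
      Real.rpow_zero]
  have hβinv : 1 ≤ β * √(p t) := by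
    rw [hβdef, Real.sqrt_eq_rpow, ← Real.rpow_add hq]
    refine Real.one_le_rpow (by exact_mod_cast hprime.one_lt.le) ?_
    rw [show (1 - t : ℝ) / (2 * t) + 1 / 2 = 1 / (2 * t) by field_simp; ring]
    positivity
  have hsq : 0 < √(p t : ℝ) := Real.sqrt_pos.2 hq
  have hsqt : 1 ≤ √(t : ℝ) := Real.one_le_sqrt.2 (by linarith)
  -- the weight vanishes for Hurwitz vectors of norm exceeding `R`
  set R : ℝ := r * Real.exp (1 / t / 4) / β with hRdef
  have hRle : R ≤ 3 * √t * √(p t) := by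
    rw [hRdef, div_le_iff₀ hβ]
    have h1 : Real.exp (1 / t / 4) ≤ 3 / 2 := by
      have h2 : (1 / t / 4 : ℝ) ≤ 1 / 12 := by
        rw [div_div, div_le_div_iff₀ (by positivity) (by norm_num)]
        linarith
      have h3 := Real.exp_bound_div_one_sub_of_interval (x := 1 / 12) (by norm_num) (by norm_num)
      have h4 := Real.exp_le_exp.2 h2
      norm_num at h3
      linarith
    calc r * Real.exp (1 / t / 4) ≤ 2 * √t * (3 / 2) := by gcongr
      _ = 3 * √t * 1 := by ring
      _ ≤ 3 * √t * (β * √(p t)) := by gcongr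
      _ = 3 * √t * √(p t) * β := by ring
  have hR0 : 0 ≤ R := by positivity
  have hRp : R < p t := by
    have h1 : 9 * (t : ℝ) < p t := by
      rw [div_lt_iff₀ hq] at hδ
      nlinarith
    have h2 : 3 * √(t : ℝ) < √(p t) := by
      refine Real.lt_sqrt_of_sq_lt ?_
      rw [mul_pow, Real.sq_sqrt htR0.le]
      linarith
    calc R ≤ 3 * √t * √(p t) := hRle
      _ < √(p t) * √(p t) := by gcongr
      _ = p t := Real.mul_self_sqrt hq.le
  have hmain : r ^ (4 * t) * unitBallVolume t / hurwitzCovolume t *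
      Real.exp (8 * t * (β * √t / r)) * (Real.exp 1 * (1 - Real.exp (-t)) / t) ≤
      (1 - ε) * (24 * ζ) *
        Real.exp (160 * (Real.exp 1 * ((t : ℝ) ^ 2 / p t) ^ (1 / 4 : ℝ))) := by
    have h1 : 8 * t * (β * √t / r) ≤
        160 * (Real.exp 1 * ((t : ℝ) ^ 2 / p t) ^ (1 / 4 : ℝ)) := by
      have h2 := mul_rpow_le (by lia : 2 ≤ t) hq (by linarith)
      have h3 : √t / r ≤ 20 := by
        rw [div_le_iff₀ hr]
        linarith
      calc 8 * t * (β * √t / r) = 8 * (t * β) * (√t / r) := by ring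
        _ ≤ 8 * (t * β) * 20 := by gcongr
        _ ≤ _ := by linarith
    have h2 : r ^ (4 * t) * unitBallVolume t / hurwitzCovolume t *
        (Real.exp 1 * (1 - Real.exp (-t)) / t) = (1 - ε) * (24 * ζ) := by
      have hne : 1 - Real.exp (-t : ℝ) ≠ 0 := (by linarith : 0 < 1 - Real.exp (-t : ℝ)).ne'
      rw [hrpow, mul_div_cancel_right₀ _ hV.ne', hc]
      field_simp
    calc _ = (1 - ε) * (24 * ζ) * Real.exp (8 * t * (β * √t / r)) := by
          rw [← h2]
          ring
      _ ≤ _ := by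
          refine mul_le_mul_of_nonneg_left (Real.exp_le_exp.2 h1) ?_
          exact mul_nonneg hε'.le (by linarith)
  have hdep : (p t : ℝ) ^ 2 * (2 * R / √(p t) + 1) ^ (4 * t) / p t ^ (t - 1) ≤
      2401 ^ 3 * 8 * ((t : ℝ) ^ 6 * (1 / 2) ^ t) := by
    refine dependent_error_le ht hq (by positivity) ?_ (by linarith)
    have h1 : R / √(p t) ≤ 3 * √t := (div_le_iff₀ hsq).2 hRle
    rw [mul_div_assoc]
    linarith
  obtain ⟨C, hC, hCr⟩ := exists_graphCode_lt_prod_quatMin ht0 e hr hβ hβp (R := R)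
    (by rw [hRdef, mul_div_cancel₀ _ hβ.ne']) hRp (lt_of_le_of_lt (add_le_add hmain hdep) hmean)
  exact ⟨scaledLift e C β, scaledLift_mem_rescaledLifts e hC, discreteTopology_scaledLift e C hβ,
    span_scaledLift e C hβ hprime.pos, nonempty_basis_scaledLift e C hβ hprime.pos, hCr⟩
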